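/- **Setting.** Let $\mathcal P\subset\mathbb N_{>1}$ be a set of pairwise coprime integers (a base). $\mathcal P$ (or a subset of it) *factorizes* a number $m\ge 1$ if $m$ is a finite product of powers of its elements, and factorizes a set if it factorizes each of its members. Let $\mathcal M\subset\mathbb N_{>1}$ be factorized by $\mathcal P$, and let $v_q=v_q(\mathcal M)\in\{0,1,\dots,\infty\}$ be the least $v$ such that $q^{v+1}\nmid m$ for all $m\in\mathcal M$ ($\infty$ if there is none). Let $\lambda>0$, $0<\pi_{\rm good}\le 1$, $P_{-1}=1\le P_0\le P_1\le\cdots$ real, $\mathcal P_j=\mathcal P\cap(P_{j-1},P_j]$, and $\mathcal P_{\le j}=\mathcal P_0\cup\dots\cup\mathcal P_j$. Let $S\subset\mathcal M$ be finite. A choice of residues is a family of integers $a_m$ $(m\in S)$. Let $S_j$ be the set of $m\in S$ factorized by $\mathcal P_{\le j}$; $C_j=\{a_m \bmod m\}_{m\in S_j}$; $R_j$ the set of integers in no class of $C_j$; and $Q_j$ the least common multiple of all divisors of elements of $S$ that are factorized by $\mathcal P_{\le j}$. Assume $R_0\neq\emptyset$. *Good classes.* For an integer $r$ and $n\mid Q_{j+1}$,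 $n>1$, factorized by $\mathcal P_{j+1}$ (a new factor), let $$\mathbf a_{n,r}=(r \bmod Q_j)\cap\bigcup_{m\mid Q_j,\ mn\in S_{j+1}}(a_{mn}\bmod mn),$$ and let $\omega'(n)$ be the number of $q\in\mathcal P$ dividing $n$. The class $r\bmod Q_j$ is *$\lambda$-good* (with respect to $C_{j+1}$) if for every $q\in\mathcal P_{j+1}$ $$\sum_{n\text{ new factor},\ q\mid n}\frac{|\mathbf a_{n,r}\bmod nQ_j|\,e^{\lambda\omega'(n)}}{n}\le 1-e^{-\lambda}.$$ *Measures and good sets.* Let $R_{-1}^*=\mathbb Z$. The measure $\mu_0$ is the uniform probability measure on the classes modulo $Q_0$ contained in $R_0$. Given $\mu_j$, a *good set at step $j$* is a union $R_j^*\subset R_{j-1}^*\cap R_j$ of $\lambda$-good classes modulo $Q_j$ with $$\frac{\mu_j(R_j^*)}{\mu_j(R_{j-1}^*\cap R_j)}\ge\pi_{\rm good}.$$ Given such a set, $\mu_{j+1}$ is defined on classes modulo $Q_{j+1}$ by $\mu_{j+1}(r)=\mu_j(r\bmod Q_j)\,/\,|R_{j+1}\cap(r\bmod Q_j)\bmod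 Q_{j+1}|$ if $r\in R_j^*\cap R_{j+1}$, and $\mu_{j+1}(r)=0$ otherwise. *Bias.* Let $\ell'_k(m)$ be the number of $k$-tuples of natural numbers factorized by $\mathcal P$ with least common multiple $m$, and $$\beta'_k(j)^k=\sum_{m\mid Q_j}\ell'_k(m)\max_{b\bmod m}\frac{\mu_j(b\bmod m)}{\mu_j(\mathbb Z/Q_j\mathbb Z)},\qquad \beta'_k(j)\ge 0.$$ **Theorem (Inductive Criterion).** Let $i\ge 0$. Let residues for $C_0,\dots,C_i$ be given, and for each $j<i$ a good set $R_j^*$ at step $j$. Suppose that for some integer $k\ge1$ $$\prod_{q\in\mathcal P_{i+1}}\Bigl(1+e^\lambda\sum_{j=1}^{v_q}\frac1{q^j}\Bigr)\le\frac{1-e^{-\lambda}}{e^\lambda}\cdot\frac{(1-\pi_{\rm good})^{1/k}}{\beta'_k(i)}\Bigl(\sum_{q\in\mathcal P_{i+1}}\Bigl(\sum_{j=1}^{v_q}\frac1{q^j}\Bigr)^k\Bigr)^{-1/k},$$ read with denominators cleared (so that it holds if the last sum is $0$). Then, for every choice of the residues of $C_{i+1}$ for the moduli in $S_{i+1}\setminus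 S_i$: 1. a good set $R_i^*\subset R_{i-1}^*\cap R_i$ at step $i$ exists; in particular $\mu_i(R_i^*)/\mu_i(R_{i-1}^*\cap R_i)\ge\pi_{\rm good}$; and for every good set $R_i^*$ at step $i$, with the resulting $\mu_{i+1}$ and $\beta'_k(i+1)$: 2. for every $r\in R_i^*$ the fiber $(r\bmod Q_i)\cap R_{i+1}$ is nonempty; 3. for all integers $k\ge1$, $$\left(\frac{\beta'_k(i+1)}{\beta'_k(i)}\right)^k\le\frac1{\pi_{\rm good}}\prod_{q\in\mathcal P_{i+1}}\Bigl(1+e^\lambda\sum_{j=1}^{v_q}\frac{(j+1)^k-j^k}{q^j}\Bigr).$$ -/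

import Mathlib

noncomputable section

namespace CoveringSieve

/-- A multiplicative base: a set of pairwise coprime natural numbers, all greater than `1`. -/
def IsBase (B : Set ℕ) : Prop :=
  (∀ q ∈ B, 1 < q) ∧ B.Pairwise Nat.Coprime

/-- `B` factorizes `m`: `m` is a (finite) product of powers of elements of `B`. -/
def Factorizes (B : Set ℕ) (m : ℕ) : Prop :=
  ∃ f : ℕ →₀ ℕ, (∀ q ∈ f.support, q ∈ B) ∧ m = f.prod (fun q v => q ^ v)

/-- The lower end of the `j`-th block: `P_{j-1}`, where `P_{-1} = 1`. -/
def lowerEnd (P : ℕ → ℝ) : ℕ → ℝ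
  | 0 => 1
  | j + 1 => P j

open scoped Classical in
/-- The block of base elements in `(P_{j-1}, P_j]`. -/
def block (B : Set ℕ) (P : ℕ → ℝ) (j : ℕ) : Finset ℕ :=
  (Finset.range (⌊P j⌋₊ + 1)).filter
    (fun q => q ∈ B ∧ lowerEnd P j < (q : ℝ) ∧ (q : ℝ) ≤ P j)

/-- The union of the blocks with index at most `j`. -/
def blocksUpTo (B : Set ℕ) (P : ℕ → ℝ) (j : ℕ) : Set ℕ :=
  {q | ∃ l ≤ j, q ∈ block B P l}

open scoped Classical in
/-- The moduli from the finite set `S` that are available at step `j`: those factorized by the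
blocks with index at most `j`. -/
def stepModuli (B : Set ℕ) (P : ℕ → ℝ) (S : Finset ℕ) (j : ℕ) : Finset ℕ :=
  S.filter (fun m => Factorizes (blocksUpTo B P j) m)

open scoped Classical in
/-- The period `Q_j`: the least common multiple of all the divisors of moduli in `S` that are
factorized by the blocks with index at most `j`. It is a multiple of every modulus available at
step `j`, and every modulus available at step `j + 1` is a divisor of `Q_j` times a number
factorized by the block of index `j + 1`. -/
def period (B : Set ℕ) (P : ℕ → ℝ) (S : Finset ℕ) (j : ℕ) : ℕ :=
  ((S.biUnion Nat.divisors).filter (fun d => Factorizes (blocksUpTo B P j) d)).lcm id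

/-- The set `R_j` of integers left uncovered by the residue classes `a m mod m`, for the moduli
`m` available at step `j`. -/
def uncovered (B : Set ℕ) (P : ℕ → ℝ) (S : Finset ℕ) (a : ℕ → ℤ) (j : ℕ) : Set ℤ :=
  {x | ∀ m ∈ stepModuli B P S j, ¬ x ≡ a m [ZMOD m]}

/-- `A` is a union of residue classes modulo `Q`. -/
def IsUnionOfClasses (Q : ℕ) (A : Set ℤ) : Prop :=
  ∀ x y : ℤ, x ≡ y [ZMOD Q] → x ∈ A → y ∈ A

open scoped Classical in
/-- The number of residue classes modulo `Q` in `A` (for `A` a union of such classes). -/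
def classCount (Q : ℕ) (A : Set ℤ) : ℕ :=
  ((Finset.Ico (0 : ℤ) Q).filter (fun x => x ∈ A)).card

open scoped Classical in
/-- The mass of a union `A` of classes modulo `Q`, where `μ r` is the mass of the class
`r mod Q`. -/
def mass (Q : ℕ) (μ : ℤ → ℝ) (A : Set ℤ) : ℝ :=
  ∑ x ∈ (Finset.Ico (0 : ℤ) Q).filter (fun x => x ∈ A), μ x

open scoped Classical in
/-- `μ_0`: the uniform probability measure on the classes modulo `Q_0` in `R_0`. -/
def initialMeasure (B : Set ℕ) (P : ℕ → ℝ) (S : Finset ℕ) (a : ℕ → ℤ) : ℤ → ℝ :=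
  fun r => if r ∈ uncovered B P S a 0 then
    1 / (classCount (period B P S 0) (uncovered B P S a 0) : ℝ) else 0

open scoped Classical in
/-- The measure at step `j + 1` obtained from the measure `μ` at step `j` and the good set `T` at
step `j`: the mass of each class in `T` is spread evenly over the uncovered part of its fiber. -/
def nextMeasure (B : Set ℕ) (P : ℕ → ℝ) (S : Finset ℕ) (a : ℕ → ℤ) (j : ℕ)
    (μ : ℤ → ℝ) (T : Set ℤ) : ℤ → ℝ :=
  fun r => if r ∈ T ∩ uncovered B P S a (j + 1) then
    μ r / (classCount (period B P S (j + 1))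
      (uncovered B P S a (j + 1) ∩ {x | x ≡ r [ZMOD period B P S j]}) : ℝ) else 0

/-- The measures `μ_j` attached to the residues `a` and the good sets `R`, where `R j` is
`R_j^*`. -/
def stepMeasure (B : Set ℕ) (P : ℕ → ℝ) (S : Finset ℕ) (a : ℕ → ℤ) (R : ℕ → Set ℤ) :
    ℕ → ℤ → ℝ
  | 0 => initialMeasure B P S a
  | j + 1 => nextMeasure B P S a j (stepMeasure B P S a R j) (R j)

/-- `R_{j-1}^*`, where `R_{-1}^*` is the set of all integers. -/
def previousGood (R : ℕ → Set ℤ) : ℕ → Set ℤ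
  | 0 => Set.univ
  | j + 1 => R j

/-- `ℓ'_k(m)`: the number of `k`-tuples of natural numbers factorized by `B` whose least common
multiple is `m`. -/
def lcmCount (B : Set ℕ) (k m : ℕ) : ℕ :=
  Nat.card {t : Fin k → ℕ // (∀ l, Factorizes B (t l)) ∧ Finset.univ.lcm t = m}

/-- The bias statistic `β'_k` of a measure `μ` on the classes modulo `Q`, which is normalized by
its total mass. -/
def bias (B : Set ℕ) (Q : ℕ) (μ : ℤ → ℝ) (k : ℕ) : ℝ :=
  (∑ m ∈ Q.divisors, (lcmCount B k m : ℝ) *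
    ⨆ b : Fin m, mass Q μ {x | x ≡ ((b : ℕ) : ℤ) [ZMOD m]} / mass Q μ Set.univ) ^ (1 / (k : ℝ))

/-- The portion `𝐚_{n,r}` of the fiber over `r mod Q_j` which is sieved out at step `j + 1` by
the moduli `m * n` with `m ∣ Q_j`. -/
def sievedOut (B : Set ℕ) (P : ℕ → ℝ) (S : Finset ℕ) (a : ℕ → ℤ) (j n : ℕ) (r : ℤ) : Set ℤ :=
  {x | x ≡ r [ZMOD period B P S j] ∧
    ∃ m, m ∣ period B P S j ∧ m * n ∈ stepModuli B P S (j + 1) ∧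
      x ≡ a (m * n) [ZMOD ((m * n : ℕ) : ℤ)]}

/-- `ω'(n)`: the number of base elements dividing `n`. -/
def baseOmega (B : Set ℕ) (n : ℕ) : ℕ :=
  Set.ncard {q | q ∈ B ∧ q ∣ n}

open scoped Classical in
/-- The new factors at step `j`: the divisors `n > 1` of `Q_j` that are factorized by the block of
index `j` alone. -/
def newFactors (B : Set ℕ) (P : ℕ → ℝ) (S : Finset ℕ) (j : ℕ) : Finset ℕ :=
  (period B P S j).divisors.filter (fun n => 1 < n ∧ Factorizes (block B P j : Set ℕ) n)

/-- The class `r mod Q_j` is `lam`-good. -/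
def IsGood (B : Set ℕ) (P : ℕ → ℝ) (S : Finset ℕ) (a : ℕ → ℤ) (lam : ℝ) (j : ℕ) (r : ℤ) : Prop :=
  ∀ q ∈ block B P (j + 1),
    ∑ n ∈ (newFactors B P S (j + 1)).filter (fun n => q ∣ n),
      (classCount (n * period B P S j) (sievedOut B P S a j n r) : ℝ) *
        Real.exp (lam * (baseOmega B n : ℝ)) / (n : ℝ) ≤ 1 - Real.exp (-lam)

/-- `T` can serve as the good set `R_j^*` at step `j`: it is a union of `lam`-good classes modulo
`Q_j`, contained in `D = R_{j-1}^* ∩ R_j`, and its share of the mass of `D` with respect to the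
measure `μ = μ_j` is at least `piGood`. Goodness is relative to the residues `a`, for the moduli
available at step `j + 1`. -/
structure IsGoodSet (B : Set ℕ) (P : ℕ → ℝ) (S : Finset ℕ) (a : ℕ → ℤ) (lam piGood : ℝ) (j : ℕ)
    (μ : ℤ → ℝ) (D T : Set ℤ) : Prop where
  isUnionOfClasses : IsUnionOfClasses (period B P S j) T
  subset : T ⊆ D
  isGood : ∀ r ∈ T, IsGood B P S a lam j r
  le_proportion : piGood ≤ mass (period B P S j) μ T / mass (period B P S j) μ D

/-- `v_q(M)`: the least `v` such that `q ^ (v + 1)` divides no element of `M`, and `⊤` if there is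
no such `v`. -/
def maxExponent (M : Set ℕ) (q : ℕ) : ℕ∞ :=
  ⨅ v ∈ {v : ℕ | ∀ m ∈ M, ¬ q ^ (v + 1) ∣ m}, (v : ℕ∞)

open scoped Classical in
/-- The (finite or infinite) sum of `c j / q ^ j` over `1 ≤ j ≤ v_q(M)`. -/
def powerSum (M : Set ℕ) (q : ℕ) (c : ℕ → ℝ) : ℝ :=
  ∑' j : ℕ, if 1 ≤ j ∧ (j : ℕ∞) ≤ maxExponent M q then c j / (q : ℝ) ^ j else 0

end CoveringSieve

end

/-! By the Chinese remainder theorem the fiber of `Q_{j+1}` over a class `r mod Q_j` is a product of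
independent coordinates `Z/q^{E_q}`, one for each `q` in the new block. What the new moduli with new
factor `n` remove from it is an event `A_n` that depends only on the coordinates `q ∣ n`. Goodness
of `r` is the hypothesis of a Lovász-type local lemma for these events: if `Z(U)` is the density of
the points avoiding all `A_n` supported in `U`, then removing `q` from `U` to get `U'` gives `Z(U) ≥
Z(U') - ∑_{q ∣ n} |A_n| Z(U' \ supp n) ≥ e^{-λ} Z(U')`, by independence and induction
(`exp_neg_mul_resMean_avoid_le`). Two consequences follow. The uncovered part of the fiber is
nonempty, and conditioning on it raises the probability of an event in the coordinates `W` by a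
factor of at most `e^{λ|W|}` (`resMean_inter_avoid_le`).

Good sets exist by a `k`-th moment Markov bound (`isGoodSet_of_criterion`). The number of classes of
`a_{n,r}` is at most the number of `m ∣ Q_j` with `r ≡ a_{mn} mod m`. Its `k`-th moment expands over
`k`-tuples of divisors, and an intersection of classes is empty or a class modulo the lcm, so the
bias bounds it (`moment_le`). Jensen's inequality combines the `n` divisible by `q`, an Euler
product bounds the total weight, and a union bound over `q` leaves bad mass at most `1 - π_good`,
which is what the criterion says.

For the growth of the bias, a class modulo `mn`, with `m ∣ Q_i` and `n` a number over the new block,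
receives at most `e^{λω'(n)}/n` times the old mass of the class modulo `m` (`mass_nextMeasure_le`),
and the total mass drops by a factor of at least `π_good` at worst. Tuples and their lcms split into
an old and a new part, and the new part sums to an Euler product in which `(j+1)^k - j^k` counts the
`k`-tuples of exponents with maximum `j` (`bias_nextMeasure_pow_le`). -/

noncomputable section

namespace CoveringSieve

/-! ### Sums and means of periodic functions on the integers. -/

/-- The function `f` only depends on the residue class modulo `N`. -/
def IsModPeriodic {α : Type*} (N : ℕ) (f : ℤ → α) : Prop :=
  ∀ x y : ℤ, x ≡ y [ZMOD N] → f x = f y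

/-- The sum of `f` over representatives of the residue classes modulo `N`. -/
def resSum (N : ℕ) (f : ℤ → ℝ) : ℝ := ∑ x ∈ Finset.Ico (0 : ℤ) N, f x

theorem IsModPeriodic.mono {α : Type*} {N N' : ℕ} {f : ℤ → α} (hf : IsModPeriodic N f)
    (h : N ∣ N') : IsModPeriodic N' f :=
  fun x y hxy => hf x y (hxy.of_dvd (by exact_mod_cast h))

theorem IsModPeriodic.mul {N : ℕ} {f g : ℤ → ℝ} (hf : IsModPeriodic N f)
    (hg : IsModPeriodic N g) : IsModPeriodic N (fun x => f x * g x) :=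
  fun x y hxy => by simp only [hf x y hxy, hg x y hxy]

theorem IsUnionOfClasses.mem_iff {N : ℕ} {A : Set ℤ} (hA : IsUnionOfClasses N A) {x y : ℤ}
    (h : x ≡ y [ZMOD N]) : x ∈ A ↔ y ∈ A :=
  ⟨hA x y h, hA y x h.symm⟩

theorem IsUnionOfClasses.mono {N N' : ℕ} {A : Set ℤ} (hA : IsUnionOfClasses N A) (h : N ∣ N') :
    IsUnionOfClasses N' A :=
  fun x y hxy => hA x y (hxy.of_dvd (by exact_mod_cast h))

theorem IsUnionOfClasses.inter {N : ℕ} {A A' : Set ℤ} (hA : IsUnionOfClasses N A)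
    (hA' : IsUnionOfClasses N A') : IsUnionOfClasses N (A ∩ A') :=
  fun x y hxy hx => ⟨hA x y hxy hx.1, hA' x y hxy hx.2⟩

theorem isUnionOfClasses_modEq {m N : ℕ} (h : m ∣ N) (b : ℤ) :
    IsUnionOfClasses N {x | x ≡ b [ZMOD m]} :=
  fun _ _ hxy hx => ((hxy.of_dvd (by exact_mod_cast h)).symm).trans hx

theorem IsUnionOfClasses.indicator {N : ℕ} {A : Set ℤ} {f : ℤ → ℝ} (hA : IsUnionOfClasses N A)
    (hf : IsModPeriodic N f) : IsModPeriodic N (A.indicator f) := by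
  classical
  intro x y hxy
  simp only [Set.indicator_apply, hA.mem_iff hxy, hf x y hxy]

theorem IsUnionOfClasses.indicator_one {N : ℕ} {A : Set ℤ} (hA : IsUnionOfClasses N A) :
    IsModPeriodic N (A.indicator (1 : ℤ → ℝ)) :=
  hA.indicator fun _ _ _ => rfl

theorem mass_eq_resSum (Q : ℕ) (μ : ℤ → ℝ) (A : Set ℤ) :
    mass Q μ A = resSum Q (A.indicator μ) := by
  classical
  unfold mass resSum
  rw [Finset.sum_filter]
  exact Finset.sum_congr rfl fun x _ => by simp [Set.indicator_apply]

theorem classCount_eq_resSum (Q : ℕ) (A : Set ℤ) :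
    (classCount Q A : ℝ) = resSum Q (A.indicator 1) := by
  classical
  unfold classCount resSum
  rw [Finset.card_filter]
  push_cast
  exact Finset.sum_congr rfl fun x _ => by simp [Set.indicator_apply]

theorem resSum_mono {N : ℕ} {f g : ℤ → ℝ} (h : ∀ x, f x ≤ g x) : resSum N f ≤ resSum N g :=
  Finset.sum_le_sum fun x _ => h x

theorem resSum_nonneg {N : ℕ} {f : ℤ → ℝ} (h : ∀ x, 0 ≤ f x) : 0 ≤ resSum N f :=
  Finset.sum_nonneg fun x _ => h x

theorem resSum_one (N : ℕ) : resSum N (fun _ => 1) = N := by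
  simp [resSum]

theorem resSum_const_mul (N : ℕ) (c : ℝ) (f : ℤ → ℝ) :
    resSum N (fun x => c * f x) = c * resSum N f := by
  simp only [resSum, Finset.mul_sum]

theorem resSum_sum {ι : Type*} (s : Finset ι) (N : ℕ) (f : ι → ℤ → ℝ) :
    resSum N (fun x => ∑ i ∈ s, f i x) = ∑ i ∈ s, resSum N (f i) :=
  Finset.sum_comm

/-- A map injective on the finitely many classes modulo `N` permutes them. -/
theorem resSum_comp {N : ℕ} (hN : 0 < N) {f : ℤ → ℝ} (hf : IsModPeriodic N f) {σ : ℤ → ℤ}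
    (hσ : ∀ x y, σ x ≡ σ y [ZMOD N] → x ≡ y [ZMOD N]) :
    resSum N (fun x => f (σ x)) = resSum N f := by
  have hN' : (0 : ℤ) < N := by exact_mod_cast hN
  have hmaps : Set.MapsTo (fun x => σ x % (N : ℤ)) (Finset.Ico (0 : ℤ) N) (Finset.Ico (0 : ℤ) N) := by
    intro x _
    simp only [Finset.coe_Ico, Set.mem_Ico]
    exact ⟨Int.emod_nonneg _ hN'.ne', Int.emod_lt_of_pos _ hN'⟩
  have hinj : Set.InjOn (fun x => σ x % (N : ℤ)) (Finset.Ico (0 : ℤ) N) := by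
    intro x hx y hy hxy
    simp only [Finset.coe_Ico, Set.mem_Ico] at hx hy
    have := hσ x y hxy
    rwa [Int.ModEq, Int.emod_eq_of_lt hx.1 hx.2, Int.emod_eq_of_lt hy.1 hy.2] at this
  refine Finset.sum_nbij (fun x => σ x % (N : ℤ)) hmaps hinj
    (Finset.surjOn_of_injOn_of_card_le _ hmaps hinj le_rfl) fun x _ => hf _ _ ?_
  exact (Int.mod_modEq _ _).symm

theorem resSum_affine {N : ℕ} (hN : 0 < N) {f : ℤ → ℝ} (hf : IsModPeriodic N f) {u : ℕ}
    (hu : Nat.Coprime u N) (r : ℤ) :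
    resSum N (fun y => f (r + u * y)) = resSum N f := by
  refine resSum_comp hN hf fun x y hxy => ?_
  have h1 : (u : ℤ) * x ≡ u * y [ZMOD N] := Int.ModEq.add_left_cancel' r hxy
  have hg : Int.gcd (N : ℤ) u = 1 := by
    rw [Int.gcd_natCast_natCast]; exact hu.symm
  simpa [hg] using Int.ModEq.cancel_left_div_gcd (by exact_mod_cast hN) h1

/-- Division with remainder, `x = r + Q * y`; neither coprimality nor periodicity is needed. -/
theorem resSum_mul (Q n : ℕ) (f : ℤ → ℝ) :
    resSum (Q * n) f = ∑ r ∈ Finset.Ico (0 : ℤ) Q, resSum n (fun y => f (r + Q * y)) := by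
  unfold resSum
  rw [← Finset.sum_product']
  symm
  refine Finset.sum_nbij' (fun p => p.1 + Q * p.2) (fun x => (x % Q, x / Q)) ?_ ?_ ?_ ?_ ?_
  · rintro ⟨r, y⟩ h
    simp only [Finset.mem_product, Finset.mem_Ico] at h ⊢
    push_cast
    obtain ⟨⟨h1, h2⟩, h3, h4⟩ := h
    refine ⟨by positivity, ?_⟩
    nlinarith
  · intro x h
    simp only [Finset.mem_product, Finset.mem_Ico] at h ⊢
    push_cast at h
    have hQ : (0 : ℤ) < Q := by
      rcases Nat.eq_zero_or_pos Q with h0 | h0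
      · subst h0; simp at h; omega
      · exact_mod_cast h0
    exact ⟨⟨Int.emod_nonneg _ hQ.ne', Int.emod_lt_of_pos _ hQ⟩, Int.ediv_nonneg h.1 hQ.le,
      Int.ediv_lt_of_lt_mul hQ (by linarith [h.2, mul_comm (n : ℤ) Q])⟩
  · rintro ⟨r, y⟩ h
    simp only [Finset.mem_product, Finset.mem_Ico] at h
    obtain ⟨⟨h1, h2⟩, h3, h4⟩ := h
    have hQ : (Q : ℤ) ≠ 0 := by omega
    simp only [Prod.mk.injEq]
    refine ⟨?_, ?_⟩
    · rw [Int.add_mul_emod_self_left, Int.emod_eq_of_lt h1 h2]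
    · rw [Int.add_mul_ediv_left _ _ hQ, Int.ediv_eq_zero_of_lt h1 h2, zero_add]
  · intro x _
    exact Int.emod_add_mul_ediv x Q
  · intro p _
    rfl

/-- The mean of `f` over the residue classes modulo `N`. -/
def resMean (N : ℕ) (f : ℤ → ℝ) : ℝ := resSum N f / N

theorem resSum_mul_of_periodic {n : ℕ} {f : ℤ → ℝ} (hf : IsModPeriodic n f) (d : ℕ) :
    resSum (n * d) f = d * resSum n f := by
  rw [resSum_mul]
  have : ∀ r : ℤ, resSum d (fun y => f (r + n * y)) = d * f r := by
    intro r
    have h : ∀ y : ℤ, f (r + n * y) = f r * 1 := fun y => by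
      rw [mul_one]; exact hf _ _ (by simp [Int.ModEq])
    simp only [h]
    rw [resSum_const_mul, resSum_one, mul_comm]
  simp only [this, ← Finset.mul_sum]
  rfl

theorem resMean_eq_of_dvd {n N : ℕ} (hN : 0 < N) (h : n ∣ N) {f : ℤ → ℝ}
    (hf : IsModPeriodic n f) : resMean N f = resMean n f := by
  obtain ⟨d, rfl⟩ := h
  have hd : (d : ℝ) ≠ 0 := by exact_mod_cast (Nat.pos_of_mul_pos_left hN).ne'
  unfold resMean
  rw [resSum_mul_of_periodic hf]
  push_cast
  rw [mul_comm (n : ℝ), mul_div_mul_left _ _ hd]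

/-- Along a class modulo `n` the first factor is constant, while `y ↦ r + n * y` runs through all
classes modulo `n'`; hence the two factors are independent. -/
theorem resMean_mul_of_coprime {n n' N : ℕ} (hN : 0 < N) (h : n ∣ N) (h' : n' ∣ N)
    (hc : Nat.Coprime n n') {f g : ℤ → ℝ} (hf : IsModPeriodic n f) (hg : IsModPeriodic n' g) :
    resMean N (fun x => f x * g x) = resMean N f * resMean N g := by
  have hn' : 0 < n' := Nat.pos_of_dvd_of_pos h' hN
  rw [resMean_eq_of_dvd hN h hf, resMean_eq_of_dvd hN h' hg,
    resMean_eq_of_dvd hN (hc.mul_dvd_of_dvd_of_dvd h h')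
      ((hf.mono (dvd_mul_right n n')).mul (hg.mono (dvd_mul_left n' n)))]
  unfold resMean
  rw [resSum_mul]
  have : ∀ r : ℤ, resSum n' (fun y => f (r + n * y) * g (r + n * y)) = f r * resSum n' g := by
    intro r
    have h : ∀ y : ℤ, f (r + n * y) = f r := fun y => hf _ _ (by simp [Int.ModEq])
    simp only [h]
    rw [resSum_const_mul, resSum_affine hn' hg hc]
  simp only [this, ← Finset.sum_mul]
  push_cast
  rw [div_mul_div_comm]
  rfl

theorem resMean_mono {N : ℕ} {f g : ℤ → ℝ} (h : ∀ x, f x ≤ g x) : resMean N f ≤ resMean N g :=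
  div_le_div_of_nonneg_right (resSum_mono h) (Nat.cast_nonneg N)

theorem resMean_nonneg {N : ℕ} {f : ℤ → ℝ} (h : ∀ x, 0 ≤ f x) : 0 ≤ resMean N f :=
  div_nonneg (resSum_nonneg h) (Nat.cast_nonneg N)

theorem resMean_one {N : ℕ} (hN : 0 < N) : resMean N (fun _ => 1) = 1 := by
  rw [resMean, resSum_one, div_self (by exact_mod_cast hN.ne')]

theorem resMean_sub (N : ℕ) (f g : ℤ → ℝ) :
    resMean N (fun x => f x - g x) = resMean N f - resMean N g := by
  simp only [resMean, resSum, Finset.sum_sub_distrib, sub_div]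

theorem resMean_sum {ι : Type*} (s : Finset ι) (N : ℕ) (f : ι → ℤ → ℝ) :
    resMean N (fun x => ∑ i ∈ s, f i x) = ∑ i ∈ s, resMean N (f i) := by
  simp only [resMean, resSum_sum, Finset.sum_div]

/-- Sums over one fiber of the projection modulo `Q`. -/
theorem resSum_fiber {Q n : ℕ} (hQ : 0 < Q) (hn : 0 < n) {f : ℤ → ℝ}
    (hf : IsModPeriodic (Q * n) f) (r : ℤ) (h0 : ∀ x, ¬ x ≡ r [ZMOD Q] → f x = 0) :
    resSum (Q * n) f = resSum n (fun y => f (r + Q * y)) := by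
  have hQ' : (0 : ℤ) < Q := by exact_mod_cast hQ
  rw [resSum_mul, Finset.sum_eq_single (r % Q)]
  · have hp : IsModPeriodic n (fun y => f (r + Q * y)) := by
      intro x y hxy
      refine hf _ _ ?_
      push_cast
      exact Int.ModEq.add_left _ (Int.ModEq.mul_left' hxy)
    -- The standard representative `r % Q` differs from `r` by a multiple of `Q`, which is a
    -- translation of the fiber coordinate by `-(r / Q)`.
    rw [← resSum_affine hn hp (Nat.coprime_one_left n) (-(r / Q))]
    congr 1
    ext y
    congr 1
    have := Int.emod_add_mul_ediv r Q
    push_cast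
    linear_combination this
  · intro s hs hne
    rw [Finset.mem_Ico] at hs
    refine Finset.sum_eq_zero fun y _ => h0 _ fun h => hne ?_
    rw [Int.ModEq, Int.add_mul_emod_self_left, Int.emod_eq_of_lt hs.1 hs.2] at h
    exact h
  · intro h
    exact absurd (Finset.mem_Ico.2 ⟨Int.emod_nonneg _ hQ'.ne', Int.emod_lt_of_pos _ hQ'⟩) h

/-! ### A local lemma for periodic events with coprime moduli. -/

section LocalLemma

variable {ι κ : Type*}

/-- The integers outside all the sets `A n`, for `n ∈ J` with support contained in `U`. -/
def avoid (J : Finset κ) (A : κ → Set ℤ) (supp : κ → Finset ι) (U : Finset ι) : Set ℤ :=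
  {y | ∀ n ∈ J, supp n ⊆ U → y ∉ A n}

theorem avoid_anti {J : Finset κ} {A : κ → Set ℤ} {supp : κ → Finset ι} {U V : Finset ι}
    (h : U ⊆ V) : avoid J A supp V ⊆ avoid J A supp U :=
  fun _ hy n hn hU => hy n hn (hU.trans h)

theorem isUnionOfClasses_avoid {J : Finset κ} {A : κ → Set ℤ} {supp : κ → Finset ι} {m : ι → ℕ}
    (hA : ∀ n ∈ J, IsUnionOfClasses (∏ q ∈ supp n, m q) (A n)) (U : Finset ι) :
    IsUnionOfClasses (∏ q ∈ U, m q) (avoid J A supp U) := by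
  intro x y hxy hx n hn hU hy
  refine hx n hn hU (hA n hn y x ?_ hy)
  exact hxy.symm.of_dvd (by exact_mod_cast Finset.prod_dvd_prod_of_subset _ _ m hU)

theorem coprime_prod_of_disjoint {K U V : Finset ι} {m : ι → ℕ}
    (hc : (K : Set ι).Pairwise (fun p q => Nat.Coprime (m p) (m q))) (hU : U ⊆ K) (hV : V ⊆ K)
    (h : Disjoint U V) : Nat.Coprime (∏ q ∈ U, m q) (∏ q ∈ V, m q) :=
  Nat.Coprime.prod_left fun _ hp => Nat.Coprime.prod_right fun _ hq =>
    hc (hU hp) (hV hq) fun he => Finset.disjoint_left.1 h hp (he ▸ hq)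

/-- Independence of periodic events whose moduli are built from disjoint parts of `K`. -/
theorem resMean_indicator_inter {K U V : Finset ι} {m : ι → ℕ}
    (hm : ∀ q ∈ K, 0 < m q)
    (hc : (K : Set ι).Pairwise (fun p q => Nat.Coprime (m p) (m q))) (hU : U ⊆ K) (hV : V ⊆ K)
    (h : Disjoint U V) {C D : Set ℤ} (hC : IsUnionOfClasses (∏ q ∈ U, m q) C)
    (hD : IsUnionOfClasses (∏ q ∈ V, m q) D) :
    resMean (∏ q ∈ K, m q) ((C ∩ D).indicator 1) =
      resMean (∏ q ∈ K, m q) (C.indicator 1) * resMean (∏ q ∈ K, m q) (D.indicator 1) := by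
  rw [← resMean_mul_of_coprime (Finset.prod_pos hm) (Finset.prod_dvd_prod_of_subset _ _ m hU)
    (Finset.prod_dvd_prod_of_subset _ _ m hV) (coprime_prod_of_disjoint hc hU hV h)
    hC.indicator_one hD.indicator_one]
  congr 1
  ext y
  rw [Set.inter_indicator_one]
  rfl

theorem indicator_one_le {C D : Set ℤ} (h : C ⊆ D) (y : ℤ) :
    C.indicator (1 : ℤ → ℝ) y ≤ D.indicator 1 y :=
  Set.indicator_le_indicator_of_subset h (fun _ => zero_le_one) y

theorem indicator_one_nonneg (C : Set ℤ) (y : ℤ) : 0 ≤ C.indicator (1 : ℤ → ℝ) y :=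
  Set.indicator_nonneg (fun _ _ => zero_le_one) y

variable [DecidableEq ι] {K : Finset ι} {m : ι → ℕ} {J : Finset κ} {A : κ → Set ℤ} {supp : κ → Finset ι}
  {lam : ℝ}

/-- One step of the local lemma: admitting one more base element to the sieve costs at most a
factor `exp (-lam)`. -/
theorem exp_neg_mul_resMean_avoid_le (hm : ∀ q ∈ K, 0 < m q)
    (hc : (K : Set ι).Pairwise (fun p q => Nat.Coprime (m p) (m q)))
    (hsupp : ∀ n ∈ J, supp n ⊆ K)
    (hA : ∀ n ∈ J, IsUnionOfClasses (∏ q ∈ supp n, m q) (A n)) (hlam : 0 ≤ lam)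
    (hgood : ∀ q ∈ K, ∑ n ∈ J.filter (fun n => q ∈ supp n),
      resMean (∏ q ∈ K, m q) ((A n).indicator 1) * Real.exp (lam * ((supp n).card : ℝ)) ≤
        1 - Real.exp (-lam)) :
    (∀ U ⊆ K, ∀ V ⊆ U, Real.exp (-(lam * ((U \ V).card : ℝ))) *
      resMean (∏ q ∈ K, m q) ((avoid J A supp V).indicator 1) ≤
        resMean (∏ q ∈ K, m q) ((avoid J A supp U).indicator 1)) := by
  classical
  intro U
  induction U using Finset.strongInduction with
  | H U ih =>
  intro hU V hV
  set Z : Finset ι → ℝ := fun W => resMean (∏ q ∈ K, m q) ((avoid J A supp W).indicator 1) with hZ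
  change _ * Z V ≤ Z U
  have hZ0 : ∀ W, 0 ≤ Z W := fun W => resMean_nonneg (indicator_one_nonneg _)
  rcases hV.eq_or_ssubset with rfl | hVU
  · simp
  obtain ⟨q, hqU, hqV⟩ := Finset.exists_of_ssubset hVU
  set U' := U.erase q with hU'
  have hU'U : U' ⊂ U := Finset.erase_ssubset hqU
  have hU'K : U' ⊆ K := hU'U.subset.trans hU
  have hVU' : V ⊆ U' := fun x hx => Finset.mem_erase.2 ⟨fun h => hqV (h ▸ hx), hV hx⟩
  have h1 := ih U' hU'U hU'K V hVU'
  have hcard : (U \ V).card = (U' \ V).card + 1 := by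
    rw [hU', Finset.erase_sdiff_comm, Finset.card_erase_add_one]
    exact Finset.mem_sdiff.2 ⟨hqU, hqV⟩
  -- Passing from `U'` to `U` adds only events with `q` in their support. For each of them,
  -- avoidance on `U'` is weakened to avoidance on `U' \ supp n`, a condition that shares no base
  -- element with `A n` and so is independent of it.
  have hpt : ∀ y, (avoid J A supp U').indicator (1 : ℤ → ℝ) y -
      ∑ n ∈ J.filter (fun n => q ∈ supp n), (A n ∩ avoid J A supp (U' \ supp n)).indicator 1 y ≤
        (avoid J A supp U).indicator 1 y := by
    intro y
    have hs0 : 0 ≤ ∑ n ∈ J.filter (fun n => q ∈ supp n),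
        (A n ∩ avoid J A supp (U' \ supp n)).indicator (1 : ℤ → ℝ) y :=
      Finset.sum_nonneg fun n _ => indicator_one_nonneg _ y
    by_cases hyU : y ∈ avoid J A supp U
    · rw [Set.indicator_of_mem hyU, Set.indicator_of_mem (avoid_anti hU'U.subset hyU)]
      linarith
    rw [Set.indicator_of_notMem hyU]
    by_cases hyU' : y ∈ avoid J A supp U'
    · obtain ⟨n, hn, hnU, hyn⟩ : ∃ n ∈ J, supp n ⊆ U ∧ y ∈ A n := by
        simpa [avoid] using hyU
      have hq : q ∈ supp n := by
        by_contra hq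
        exact hyU' n hn (fun x hx => Finset.mem_erase.2 ⟨fun h => hq (h ▸ hx), hnU hx⟩) hyn
      have := Finset.single_le_sum
        (f := fun n => (A n ∩ avoid J A supp (U' \ supp n)).indicator (1 : ℤ → ℝ) y)
        (fun n _ => indicator_one_nonneg _ y)
        (Finset.mem_filter.2 ⟨hn, hq⟩ : n ∈ J.filter (fun n => q ∈ supp n))
      rw [Set.indicator_of_mem (show y ∈ A n ∩ avoid J A supp (U' \ supp n) from
        ⟨hyn, avoid_anti Finset.sdiff_subset hyU'⟩)] at this
      rw [Set.indicator_of_mem hyU']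
      simp only [Pi.one_apply] at this ⊢
      linarith
    · rw [Set.indicator_of_notMem hyU']
      linarith
  have hmean := resMean_mono (N := ∏ q ∈ K, m q) hpt
  rw [resMean_sub, resMean_sum] at hmean
  have hterm : ∀ n ∈ J.filter (fun n => q ∈ supp n),
      resMean (∏ q ∈ K, m q) ((A n ∩ avoid J A supp (U' \ supp n)).indicator 1) ≤
        resMean (∏ q ∈ K, m q) ((A n).indicator 1) * Real.exp (lam * ((supp n).card : ℝ)) *
          Z U' := by
    intro n hn
    obtain ⟨hn, hq⟩ := Finset.mem_filter.1 hn
    rw [resMean_indicator_inter hm hc (hsupp n hn) (Finset.sdiff_subset.trans hU'K)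
      Finset.disjoint_sdiff (hA n hn) (isUnionOfClasses_avoid hA _), mul_assoc]
    refine mul_le_mul_of_nonneg_left ?_ (resMean_nonneg (indicator_one_nonneg _))
    -- Undoing the weakening costs at most `exp (lam * |supp n|)`. This use of the induction
    -- hypothesis is why the claim is proved for all `V ⊆ U` at once.
    have h2 := ih U' hU'U hU'K (U' \ supp n) Finset.sdiff_subset
    change Real.exp (-_) * Z (U' \ supp n) ≤ Z U' at h2
    change Z (U' \ supp n) ≤ _ * Z U'
    have hle : ((U' \ (U' \ supp n)).card : ℝ) ≤ (supp n).card := by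
      rw [sdiff_sdiff_right_self]
      exact_mod_cast Finset.card_le_card Finset.inter_subset_right
    calc Z (U' \ supp n) = Real.exp (lam * ((U' \ (U' \ supp n)).card : ℝ)) *
          (Real.exp (-(lam * ((U' \ (U' \ supp n)).card : ℝ))) * Z (U' \ supp n)) := by
            rw [← mul_assoc, ← Real.exp_add]; simp
      _ ≤ Real.exp (lam * ((U' \ (U' \ supp n)).card : ℝ)) * Z U' :=
            mul_le_mul_of_nonneg_left h2 (Real.exp_nonneg _)
      _ ≤ Real.exp (lam * ((supp n).card : ℝ)) * Z U' :=
            mul_le_mul_of_nonneg_right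
              (Real.exp_le_exp.2 (mul_le_mul_of_nonneg_left hle hlam)) (hZ0 _)
  have hsum := Finset.sum_le_sum hterm
  rw [← Finset.sum_mul] at hsum
  have hg := mul_le_mul_of_nonneg_right (hgood q (hU hqU)) (hZ0 U')
  have hstep : Real.exp (-lam) * Z U' ≤ Z U := by
    change Z U' - _ ≤ Z U at hmean
    linarith
  calc Real.exp (-(lam * ((U \ V).card : ℝ))) * Z V
      = Real.exp (-lam) * (Real.exp (-(lam * ((U' \ V).card : ℝ))) * Z V) := by
        rw [hcard, ← mul_assoc, ← Real.exp_add]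
        push_cast
        ring_nf
    _ ≤ Real.exp (-lam) * Z U' := mul_le_mul_of_nonneg_left h1 (Real.exp_nonneg _)
    _ ≤ Z U := hstep

/-- Compare `K` with the empty set. Since no support is empty, the empty set leaves nothing to avoid
and the density there is `1`. -/
theorem resMean_avoid_pos (hm : ∀ q ∈ K, 0 < m q)
    (hc : (K : Set ι).Pairwise (fun p q => Nat.Coprime (m p) (m q)))
    (hsupp : ∀ n ∈ J, supp n ⊆ K) (hne : ∀ n ∈ J, (supp n).Nonempty)
    (hA : ∀ n ∈ J, IsUnionOfClasses (∏ q ∈ supp n, m q) (A n)) (hlam : 0 ≤ lam)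
    (hgood : ∀ q ∈ K, ∑ n ∈ J.filter (fun n => q ∈ supp n),
      resMean (∏ q ∈ K, m q) ((A n).indicator 1) * Real.exp (lam * ((supp n).card : ℝ)) ≤
        1 - Real.exp (-lam)) :
    0 < resMean (∏ q ∈ K, m q) ((avoid J A supp K).indicator 1) := by
  refine lt_of_lt_of_le ?_ (exp_neg_mul_resMean_avoid_le hm hc hsupp hA hlam hgood K
    (Finset.Subset.refl K) ∅ (Finset.empty_subset K))
  have : avoid J A supp ∅ = Set.univ := Set.eq_univ_of_forall fun y n hn h =>
    absurd (Finset.subset_empty.1 h) (hne n hn).ne_empty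
  rw [this, Set.indicator_univ]
  exact mul_pos (Real.exp_pos _)
    ((resMean_one (Finset.prod_pos hm)).symm ▸ zero_lt_one : (0 : ℝ) < resMean _ (fun _ => 1))

/-- An event involving only the base elements in `W` is at most `exp (lam * |W|)` times more
likely on the unsieved set than overall. -/
theorem resMean_inter_avoid_le (hm : ∀ q ∈ K, 0 < m q)
    (hc : (K : Set ι).Pairwise (fun p q => Nat.Coprime (m p) (m q)))
    (hsupp : ∀ n ∈ J, supp n ⊆ K)
    (hA : ∀ n ∈ J, IsUnionOfClasses (∏ q ∈ supp n, m q) (A n)) (hlam : 0 ≤ lam)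
    (hgood : ∀ q ∈ K, ∑ n ∈ J.filter (fun n => q ∈ supp n),
      resMean (∏ q ∈ K, m q) ((A n).indicator 1) * Real.exp (lam * ((supp n).card : ℝ)) ≤
        1 - Real.exp (-lam))
    {W : Finset ι} (hW : W ⊆ K) {C : Set ℤ} (hC : IsUnionOfClasses (∏ q ∈ W, m q) C) :
    resMean (∏ q ∈ K, m q) ((C ∩ avoid J A supp K).indicator 1) ≤
      resMean (∏ q ∈ K, m q) (C.indicator 1) * Real.exp (lam * (W.card : ℝ)) *
        resMean (∏ q ∈ K, m q) ((avoid J A supp K).indicator 1) := by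
  -- Dropping the events that meet `W` leaves a condition independent of `C`; restoring them costs
  -- `exp (lam * |W|)`.
  have h := exp_neg_mul_resMean_avoid_le hm hc hsupp hA hlam hgood K
    (Finset.Subset.refl K) (K \ W) Finset.sdiff_subset
  rw [Finset.sdiff_sdiff_eq_self hW] at h
  calc _ ≤ resMean (∏ q ∈ K, m q) ((C ∩ avoid J A supp (K \ W)).indicator 1) :=
        resMean_mono (indicator_one_le
          (Set.inter_subset_inter_right C (avoid_anti Finset.sdiff_subset)))
    _ = resMean (∏ q ∈ K, m q) (C.indicator 1) *
          resMean (∏ q ∈ K, m q) ((avoid J A supp (K \ W)).indicator 1) :=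
        resMean_indicator_inter hm hc hW Finset.sdiff_subset Finset.disjoint_sdiff hC
          (isUnionOfClasses_avoid hA _)
    _ = resMean (∏ q ∈ K, m q) (C.indicator 1) * (Real.exp (lam * (W.card : ℝ)) *
          (Real.exp (-(lam * (W.card : ℝ))) *
            resMean (∏ q ∈ K, m q) ((avoid J A supp (K \ W)).indicator 1))) := by
        rw [← mul_assoc (Real.exp _), ← Real.exp_add]; simp
    _ ≤ _ := by
        rw [mul_assoc]
        exact mul_le_mul_of_nonneg_left (mul_le_mul_of_nonneg_left h (Real.exp_nonneg _))
          (resMean_nonneg (indicator_one_nonneg _))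

end LocalLemma

/-! ### Factorization over a base of pairwise coprime numbers. -/

/-- The product of the powers `q ^ f q`. -/
def baseProd (f : ℕ →₀ ℕ) : ℕ := f.prod (fun q v => q ^ v)

theorem Factorizes.mono {U V : Set ℕ} {m : ℕ} (h : Factorizes U m) (hUV : U ⊆ V) :
    Factorizes V m := by
  obtain ⟨f, hf, hm⟩ := h
  exact ⟨f, fun q hq => hUV (hf q hq), hm⟩

theorem factorizes_one (U : Set ℕ) : Factorizes U 1 := ⟨0, by simp, by simp⟩

theorem baseProd_add (f g : ℕ →₀ ℕ) : baseProd (f + g) = baseProd f * baseProd g :=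
  Finsupp.prod_add_index' (fun q => pow_zero q) fun q => pow_add q

theorem Factorizes.mul {U : Set ℕ} {m n : ℕ} (hm : Factorizes U m) (hn : Factorizes U n) :
    Factorizes U (m * n) := by
  classical
  obtain ⟨f, hf, rfl⟩ := hm
  obtain ⟨g, hg, rfl⟩ := hn
  refine ⟨f + g, fun q hq => ?_, (baseProd_add f g).symm⟩
  rcases Finset.mem_union.1 (Finsupp.support_add hq) with h | h
  exacts [hf q h, hg q h]

theorem factorizes_pow {U : Set ℕ} {q : ℕ} (hq : q ∈ U) (e : ℕ) : Factorizes U (q ^ e) := by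
  classical
  refine ⟨Finsupp.single q e, fun p hp => ?_, ?_⟩
  · rw [Finset.mem_singleton.1 (Finsupp.support_single_subset hp)]
    exact hq
  · rw [Finsupp.prod_single_index (pow_zero q)]

theorem Factorizes.split {U V : Set ℕ} {m : ℕ} (h : Factorizes (U ∪ V) m) :
    ∃ u v, Factorizes U u ∧ Factorizes V v ∧ m = u * v := by
  classical
  obtain ⟨f, hf, rfl⟩ := h
  refine ⟨baseProd (f.filter (· ∈ U)), baseProd (f.filter (· ∉ U)), ⟨_, ?_, rfl⟩, ⟨_, ?_, rfl⟩, ?_⟩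
  · intro q hq
    rw [Finsupp.support_filter, Finset.mem_filter] at hq
    exact hq.2
  · intro q hq
    rw [Finsupp.support_filter, Finset.mem_filter] at hq
    exact (hf q hq.1).resolve_left hq.2
  · rw [← baseProd_add, Finsupp.filter_add_filter_not]
    rfl

section Base

variable {B : Set ℕ} (hB : IsBase B)

include hB

theorem IsBase.baseProd_pos {f : ℕ →₀ ℕ} (hf : ∀ q ∈ f.support, q ∈ B) : 0 < baseProd f :=
  Finset.prod_pos fun q hq => pow_pos (zero_lt_one.trans (hB.1 q (hf q hq))) _

theorem Factorizes.pos {U : Set ℕ} (hU : U ⊆ B) {m : ℕ} (h : Factorizes U m) : 0 < m := by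
  obtain ⟨f, hf, rfl⟩ := h
  exact hB.baseProd_pos fun q hq => hU (hf q hq)

theorem Factorizes.coprime {U V : Set ℕ} (hU : U ⊆ B) (hV : V ⊆ B) (hd : Disjoint U V) {m n : ℕ}
    (hm : Factorizes U m) (hn : Factorizes V n) : Nat.Coprime m n := by
  obtain ⟨f, hf, rfl⟩ := hm
  obtain ⟨g, hg, rfl⟩ := hn
  refine Nat.Coprime.prod_left fun p hp => Nat.Coprime.prod_right fun q hq =>
    Nat.Coprime.pow _ _ (hB.2 (hU (hf p hp)) (hV (hg q hq)) ?_)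
  rintro rfl
  exact Set.disjoint_left.1 hd (hf p hp) (hg p hq)

/-- Base elements need not be prime, but the cofactor of `q ^ f q` is coprime to `q`, so
divisibility by powers of `q` still reads off the exponent. -/
theorem IsBase.pow_dvd_baseProd_iff {f : ℕ →₀ ℕ} (hf : ∀ q ∈ f.support, q ∈ B) {q : ℕ}
    (hq : q ∈ B) (e : ℕ) : q ^ e ∣ baseProd f ↔ e ≤ f q := by
  classical
  have h1 : baseProd f = q ^ f q * baseProd (f.erase q) := by
    rw [← Finsupp.single_add_erase q f, baseProd_add]
    congr 1
    · rw [baseProd, Finsupp.prod_single_index (pow_zero q)]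
      simp
    · simp
  have h2 : Nat.Coprime (q ^ e) (baseProd (f.erase q)) := by
    refine Factorizes.coprime hB (U := {q}) (V := B \ {q}) (by simpa using hq)
      Set.sdiff_subset Set.disjoint_sdiff_right (factorizes_pow (Set.mem_singleton q) e) ⟨f.erase q, ?_, rfl⟩
    intro p hp
    rw [Finsupp.support_erase, Finset.mem_erase] at hp
    exact ⟨hf p hp.2, hp.1⟩
  rw [h1, h2.dvd_mul_right, Nat.pow_dvd_pow_iff_le_right (hB.1 q hq)]

theorem IsBase.finiteMultiplicity {q n : ℕ} (hq : q ∈ B) (hn : 0 < n) : FiniteMultiplicity q n :=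
  Nat.finiteMultiplicity_iff.2 ⟨(hB.1 q hq).ne', hn⟩

theorem IsBase.multiplicity_baseProd {f : ℕ →₀ ℕ} (hf : ∀ q ∈ f.support, q ∈ B) {q : ℕ}
    (hq : q ∈ B) : multiplicity q (baseProd f) = f q := by
  have h := hB.finiteMultiplicity hq (hB.baseProd_pos hf)
  refine le_antisymm ?_ ?_
  · rw [← hB.pow_dvd_baseProd_iff hf hq, h.pow_dvd_iff_le_multiplicity]
  · rw [← h.pow_dvd_iff_le_multiplicity, hB.pow_dvd_baseProd_iff hf hq]

theorem IsBase.baseProd_dvd {f : ℕ →₀ ℕ} (hf : ∀ q ∈ f.support, q ∈ B) {c : ℕ}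
    (h : ∀ q ∈ f.support, q ^ f q ∣ c) : baseProd f ∣ c := by
  exact Finset.prod_dvd_of_isRelPrime (fun p hp q hq hpq => Nat.coprime_iff_isRelPrime.1
    (Nat.Coprime.pow _ _ (hB.2 (hf p hp) (hf q hq) hpq))) h

theorem Factorizes.eq_prod {K : Finset ℕ} (hK : (K : Set ℕ) ⊆ B) {m : ℕ}
    (h : Factorizes (K : Set ℕ) m) : m = ∏ q ∈ K, q ^ multiplicity q m := by
  obtain ⟨f, hf, rfl⟩ := h
  change baseProd f = ∏ q ∈ K, q ^ multiplicity q (baseProd f)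
  rw [Finset.prod_congr rfl fun q hq => by
    rw [hB.multiplicity_baseProd (fun q hq => hK (hf q hq)) (hK hq)]]
  exact Finsupp.prod_of_support_subset f (fun q hq => hf q hq) _ fun q _ => pow_zero q

theorem Factorizes.dvd_of_pow_dvd {U : Set ℕ} (hU : U ⊆ B) {m c : ℕ} (h : Factorizes U m)
    (hc : ∀ q ∈ U, ∀ e, q ^ e ∣ m → q ^ e ∣ c) : m ∣ c := by
  obtain ⟨f, hf, rfl⟩ := h
  have hfB := fun q hq => hU (hf q hq)
  exact hB.baseProd_dvd hfB fun q hq =>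
    hc q (hf q hq) _ ((hB.pow_dvd_baseProd_iff hfB (hfB q hq) _).2 le_rfl)

theorem Factorizes.multiplicity_eq_zero {U : Set ℕ} (hU : U ⊆ B) {m q : ℕ}
    (h : Factorizes U m) (hq : q ∈ B) (hqU : q ∉ U) : multiplicity q m = 0 := by
  obtain ⟨f, hf, rfl⟩ := h
  change multiplicity q (baseProd f) = 0
  rw [hB.multiplicity_baseProd (fun q hq => hU (hf q hq)) hq, ← Finsupp.notMem_support_iff]
  exact fun h => hqU (hf q h)

/-- That `m` is a product over the base has to be assumed: with composite base elements, a divisor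
of such a product need not be one. -/
theorem Factorizes.restrict {U : Set ℕ} {m c : ℕ} (h : Factorizes B m)
    (hU : U ⊆ B) (hm : m ∣ c) (hc : Factorizes U c) : Factorizes U m := by
  obtain ⟨f, hf, rfl⟩ := h
  refine ⟨f, fun q hq => ?_, rfl⟩
  by_contra hqU
  have h0 := Factorizes.multiplicity_eq_zero hB hU hc (hf q hq) hqU
  have h1 : q ^ f q ∣ c := ((hB.pow_dvd_baseProd_iff hf (hf q hq) _).2 le_rfl).trans hm
  rw [(hB.finiteMultiplicity (hf q hq) (Factorizes.pos hB hU hc)).pow_dvd_iff_le_multiplicity,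
    h0] at h1
  exact (Finsupp.mem_support_iff.1 hq) (Nat.le_zero.1 h1)

theorem Factorizes.of_mul_right {U : Set ℕ} (hU : U ⊆ B) {m n : ℕ} (h : Factorizes U (m * n))
    (hn : Factorizes U n) : Factorizes U m := by
  obtain ⟨f, hf, hmn⟩ := h
  obtain ⟨g, hg, rfl⟩ := hn
  have hfB := fun q hq => hU (hf q hq)
  have hgB := fun q hq => hU (hg q hq)
  have hle : g ≤ f := fun q => by
    by_cases hq : q ∈ g.support
    · rw [← hB.pow_dvd_baseProd_iff hfB (hgB q hq)]
      exact ((hB.pow_dvd_baseProd_iff hgB (hgB q hq) _).2 le_rfl).trans ⟨m, by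
        rw [mul_comm]; exact hmn.symm⟩
    · rw [Finsupp.notMem_support_iff.1 hq]
      exact Nat.zero_le _
  refine ⟨f - g, fun q hq => hf q (Finsupp.support_tsub hq), ?_⟩
  refine Nat.eq_of_mul_eq_mul_right (hB.baseProd_pos hgB) ?_
  change m * baseProd g = baseProd (f - g) * baseProd g
  rw [← baseProd_add, tsub_add_cancel_of_le hle]
  exact hmn

theorem Factorizes.lcm {U : Set ℕ} (hU : U ⊆ B) {m n : ℕ} (hm : Factorizes U m)
    (hn : Factorizes U n) : Factorizes U (Nat.lcm m n) ∧
      ∀ q ∈ B, multiplicity q (Nat.lcm m n) = multiplicity q m ⊔ multiplicity q n := by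
  classical
  obtain ⟨f, hf, rfl⟩ := hm
  obtain ⟨g, hg, rfl⟩ := hn
  have hfB := fun q hq => hU (hf q hq)
  have hgB := fun q hq => hU (hg q hq)
  have hfg : ∀ q ∈ (f ⊔ g).support, q ∈ U := fun q hq => by
    rw [Finsupp.support_sup, Finset.mem_union] at hq
    rcases hq with h | h
    exacts [hf q h, hg q h]
  have hfgB := fun q hq => hU (hfg q hq)
  have key : Nat.lcm (baseProd f) (baseProd g) = baseProd (f ⊔ g) := by
    refine Nat.dvd_antisymm (Nat.lcm_dvd ?_ ?_) (hB.baseProd_dvd hfgB fun q hq => ?_)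
    · exact hB.baseProd_dvd hfB fun q hq =>
        (hB.pow_dvd_baseProd_iff hfgB (hfB q hq) _).2 le_sup_left
    · exact hB.baseProd_dvd hgB fun q hq =>
        (hB.pow_dvd_baseProd_iff hfgB (hgB q hq) _).2 le_sup_right
    · rw [Finsupp.sup_apply]
      rcases le_total (f q) (g q) with h | h
      · rw [sup_eq_right.2 h]
        exact ((hB.pow_dvd_baseProd_iff hgB (hfgB q hq) _).2 le_rfl).trans (Nat.dvd_lcm_right _ _)
      · rw [sup_eq_left.2 h]
        exact ((hB.pow_dvd_baseProd_iff hfB (hfgB q hq) _).2 le_rfl).trans (Nat.dvd_lcm_left _ _)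
  change Factorizes U (Nat.lcm (baseProd f) (baseProd g)) ∧ ∀ q ∈ B,
    multiplicity q (Nat.lcm (baseProd f) (baseProd g)) =
      multiplicity q (baseProd f) ⊔ multiplicity q (baseProd g)
  rw [key]
  refine ⟨⟨_, hfg, rfl⟩, fun q hq => ?_⟩
  rw [hB.multiplicity_baseProd hfgB hq, hB.multiplicity_baseProd hfB hq,
    hB.multiplicity_baseProd hgB hq, Finsupp.sup_apply]

theorem Factorizes.finset_lcm {κ : Type*} {U : Set ℕ} (hU : U ⊆ B) (s : Finset κ) (t : κ → ℕ)
    (ht : ∀ x ∈ s, Factorizes U (t x)) : Factorizes U (s.lcm t) ∧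
      ∀ q ∈ B, multiplicity q (s.lcm t) = s.sup (fun x => multiplicity q (t x)) := by
  classical
  induction s using Finset.induction_on with
  | empty =>
    refine ⟨by simpa using factorizes_one U, fun q hq => ?_⟩
    simpa using Factorizes.multiplicity_eq_zero hB (Set.empty_subset B) (factorizes_one ∅) hq
      (Set.notMem_empty q)
  | insert x s hx ih =>
    obtain ⟨h1, h2⟩ := ih fun y hy => ht y (Finset.mem_insert_of_mem hy)
    rw [Finset.lcm_insert]
    obtain ⟨h3, h4⟩ := Factorizes.lcm hB hU (ht x (Finset.mem_insert_self x s)) h1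
    refine ⟨h3, fun q hq => ?_⟩
    rw [Finset.sup_insert, ← h2 q hq]
    exact h4 q hq

theorem Factorizes.split_of_dvd {U V : Set ℕ} (hU : U ⊆ B) (hV : V ⊆ B) (hd : Disjoint U V)
    {Q N t : ℕ} (hQ : Factorizes U Q) (hN : Factorizes V N) (ht : Factorizes B t)
    (htd : t ∣ Q * N) :
    ∃ u v, Factorizes U u ∧ Factorizes V v ∧ u ∣ Q ∧ v ∣ N ∧ t = u * v := by
  obtain ⟨u, v, hu, hv, rfl⟩ := (Factorizes.restrict hB ht (Set.union_subset hU hV) htd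
    ((hQ.mono Set.subset_union_left).mul (hN.mono Set.subset_union_right))).split
  refine ⟨u, v, hu, hv, ?_, ?_, rfl⟩
  · exact (Factorizes.coprime hB hU hV hd hu hN).dvd_of_dvd_mul_right
      ((dvd_mul_right u v).trans htd)
  · exact (Factorizes.coprime hB hU hV hd hQ hv).symm.dvd_of_dvd_mul_left
      ((dvd_mul_left v u).trans htd)

end Base


/-! ### The periods `Q_j` and their factorization along the blocks. -/

section Period

variable {B : Set ℕ} {P : ℕ → ℝ} {S : Finset ℕ}

theorem block_subset (j : ℕ) : (block B P j : Set ℕ) ⊆ B := by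
  classical
  intro q hq
  simp only [block, Finset.coe_filter, Set.mem_ofPred_eq] at hq
  exact hq.2.1

theorem blocksUpTo_subset (j : ℕ) : blocksUpTo B P j ⊆ B :=
  fun _ ⟨_, _, hq⟩ => block_subset _ hq

theorem blocksUpTo_succ (j : ℕ) :
    blocksUpTo B P (j + 1) = blocksUpTo B P j ∪ (block B P (j + 1) : Set ℕ) := by
  ext q
  simp only [blocksUpTo, Set.mem_ofPred_eq, Set.mem_union, Finset.mem_coe]
  constructor
  · rintro ⟨l, hl, hq⟩
    rcases hl.lt_or_eq with h | rfl
    · exact Or.inl ⟨l, Nat.lt_succ_iff.1 h, hq⟩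
    · exact Or.inr hq
  · rintro (⟨l, hl, hq⟩ | hq)
    · exact ⟨l, hl.trans (Nat.le_succ j), hq⟩
    · exact ⟨j + 1, le_rfl, hq⟩

theorem disjoint_blocksUpTo_block (hP : Monotone P) (j : ℕ) :
    Disjoint (blocksUpTo B P j) (block B P (j + 1) : Set ℕ) := by
  classical
  rw [Set.disjoint_left]
  rintro q ⟨l, hl, hq⟩ hq'
  rw [block, Finset.mem_filter] at hq
  rw [Finset.mem_coe, block, Finset.mem_filter] at hq'
  exact absurd (hq.2.2.2.trans (hP hl)) (not_le.2 hq'.2.2.1)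

variable (hB : IsBase B)

include hB

theorem period_factorizes (j : ℕ) : Factorizes (blocksUpTo B P j) (period B P S j) := by
  classical
  exact (Factorizes.finset_lcm hB (blocksUpTo_subset j) _ id fun d hd =>
    (Finset.mem_filter.1 hd).2).1

theorem period_pos (j : ℕ) : 0 < period B P S j :=
  Factorizes.pos hB (blocksUpTo_subset j) (period_factorizes hB j)

omit hB in
theorem dvd_period {j m d : ℕ} (hm : m ∈ S) (hm0 : m ≠ 0) (hd : d ∣ m)
    (hdf : Factorizes (blocksUpTo B P j) d) : d ∣ period B P S j := by
  classical
  exact Finset.dvd_lcm (f := id) (Finset.mem_filter.2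
    ⟨Finset.mem_biUnion.2 ⟨m, hm, Nat.mem_divisors.2 ⟨hd, hm0⟩⟩, hdf⟩)

/-- The exponent of `q` in an lcm of factorized numbers is the largest of their exponents, so one of
them attains it. The case `e = 0` is excluded because `S` may be empty. -/
theorem exists_pow_dvd_of_pow_dvd_period {j q e : ℕ} (hq : q ∈ blocksUpTo B P j)
    (he : e ≠ 0) (h : q ^ e ∣ period B P S j) : ∃ m ∈ S, m ≠ 0 ∧ q ^ e ∣ m := by
  classical
  have hqB := blocksUpTo_subset j hq
  have hsup := (Factorizes.finset_lcm hB (blocksUpTo_subset j)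
    ((S.biUnion Nat.divisors).filter (fun d => Factorizes (blocksUpTo B P j) d)) id fun d hd =>
    (Finset.mem_filter.1 hd).2).2 q hqB
  rw [(hB.finiteMultiplicity hqB (period_pos hB j)).pow_dvd_iff_le_multiplicity, period,
    hsup, Finset.le_sup_iff (Nat.pos_of_ne_zero he)] at h
  obtain ⟨d, hd, hle⟩ := h
  rw [Finset.mem_filter, Finset.mem_biUnion] at hd
  obtain ⟨⟨m, hm, hdm⟩, -⟩ := hd
  rw [Nat.mem_divisors] at hdm
  refine ⟨m, hm, hdm.2, (((hB.finiteMultiplicity hqB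
    (Nat.pos_of_dvd_of_pos hdm.1 (Nat.pos_of_ne_zero hdm.2))).pow_dvd_iff_le_multiplicity).2
      hle).trans hdm.1⟩

omit hB in
theorem period_dvd_period_succ (j : ℕ) : period B P S j ∣ period B P S (j + 1) := by
  classical
  refine Finset.lcm_dvd fun d hd => ?_
  rw [Finset.mem_filter, Finset.mem_biUnion] at hd
  obtain ⟨⟨m, hm, hdm⟩, hdf⟩ := hd
  rw [Nat.mem_divisors] at hdm
  exact dvd_period hm hdm.2 hdm.1 (hdf.mono ((blocksUpTo_succ j).symm ▸ Set.subset_union_left))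

/-- The exponent of the base element `q` in the period of step `j`. -/
def periodExponent (B : Set ℕ) (P : ℕ → ℝ) (S : Finset ℕ) (j q : ℕ) : ℕ :=
  multiplicity q (period B P S j)

/-- The part of the period of step `j` that is factorized by the block of index `j`. -/
def newPeriod (B : Set ℕ) (P : ℕ → ℝ) (S : Finset ℕ) (j : ℕ) : ℕ :=
  ∏ q ∈ block B P j, q ^ periodExponent B P S j q

omit hB in
theorem newPeriod_factorizes (j : ℕ) :
    Factorizes (block B P j : Set ℕ) (newPeriod B P S j) := by
  classical
  unfold newPeriod
  refine Finset.prod_induction _ _ (fun _ _ => Factorizes.mul) (factorizes_one _) fun q hq => ?_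
  exact factorizes_pow (Finset.mem_coe.2 hq) _

theorem newPeriod_pos (j : ℕ) : 0 < newPeriod B P S j :=
  Factorizes.pos hB (block_subset j) (newPeriod_factorizes j)

/-- The part of `Q_{j+1}` over the old blocks divides `Q_j`: each power `q ^ e` in it divides some
modulus in `S` and, being factorized by the old blocks, already enters `Q_j`. This is where it
matters that the period is the lcm of divisors of moduli, not only of the available moduli. -/
theorem period_succ (hP : Monotone P) (j : ℕ) :
    period B P S (j + 1) = period B P S j * newPeriod B P S (j + 1) := by
  have hfac := period_factorizes (P := P) (S := S) hB (j + 1)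
  have hpos := period_pos (P := P) (S := S) hB (j + 1)
  have hd := disjoint_blocksUpTo_block (B := B) hP j
  have hcop : ∀ m n, Factorizes (blocksUpTo B P j) m → Factorizes (block B P (j + 1) : Set ℕ) n →
    Nat.Coprime m n := fun m n => Factorizes.coprime hB (blocksUpTo_subset j) (block_subset _) hd
  have h0 := period_factorizes (P := P) (S := S) hB j
  have h1 : newPeriod B P S (j + 1) ∣ period B P S (j + 1) := by
    refine Factorizes.dvd_of_pow_dvd hB (block_subset _) (newPeriod_factorizes _)
      fun q hq e he => ?_
    have hqB : q ∈ B := block_subset _ hq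
    rw [newPeriod, ← Finset.mul_prod_erase _ _ (Finset.mem_coe.1 hq)] at he
    have hc : Nat.Coprime (q ^ e)
        (∏ p ∈ (block B P (j + 1)).erase q, p ^ periodExponent B P S (j + 1) p) :=
      Nat.Coprime.prod_right fun p hp => Nat.Coprime.pow _ _
        (hB.2 hqB (block_subset _ (Finset.mem_coe.2 (Finset.mem_of_mem_erase hp)))
          (Finset.ne_of_mem_erase hp).symm)
    refine (hc.dvd_of_dvd_mul_right he).trans ?_
    exact pow_multiplicity_dvd q _
  refine Nat.dvd_antisymm ?_
    ((hcop _ _ h0 (newPeriod_factorizes _)).mul_dvd_of_dvd_of_dvd (period_dvd_period_succ j) h1)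
  rw [blocksUpTo_succ] at hfac
  obtain ⟨u, v, hu, hv, huv⟩ := hfac.split
  rw [huv] at hpos ⊢
  refine mul_dvd_mul ?_ ?_
  · refine Factorizes.dvd_of_pow_dvd hB (blocksUpTo_subset j) hu fun q hq e he => ?_
    rcases Nat.eq_zero_or_pos e with rfl | he0
    · simp
    obtain ⟨m, hm, hm0, hem⟩ := exists_pow_dvd_of_pow_dvd_period hB (P := P) (S := S) (j := j + 1)
      (by rw [blocksUpTo_succ]; exact Or.inl hq) he0.ne' (huv ▸ he.trans (dvd_mul_right u v))
    exact dvd_period hm hm0 hem (factorizes_pow hq e)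
  · refine Factorizes.dvd_of_pow_dvd hB (block_subset _) hv fun q hq e he => ?_
    have hqB : q ∈ B := block_subset _ hq
    have h2 : e ≤ periodExponent B P S (j + 1) q := by
      rw [periodExponent, huv,
        ← (hB.finiteMultiplicity hqB hpos).pow_dvd_iff_le_multiplicity]
      exact he.trans (dvd_mul_left v u)
    exact (pow_dvd_pow q h2).trans (Finset.dvd_prod_of_mem
      (fun q => q ^ periodExponent B P S (j + 1) q) (Finset.mem_coe.1 hq))

theorem coprime_period_newPeriod (hP : Monotone P) (j : ℕ) :
    Nat.Coprime (period B P S j) (newPeriod B P S (j + 1)) :=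
  Factorizes.coprime hB (blocksUpTo_subset j) (block_subset _) (disjoint_blocksUpTo_block hP j)
    (period_factorizes hB j) (newPeriod_factorizes _)

/-- A power of `q` in the period divides a single element of `M`. Hence the finite local sums over
actual exponents can be completed to `powerSum`. -/
theorem periodExponent_le_maxExponent {M : Set ℕ} (hS : ∀ m ∈ S, m ∈ M) {j q : ℕ}
    (hq : q ∈ block B P j) : (periodExponent B P S j q : ℕ∞) ≤ maxExponent M q := by
  rcases Nat.eq_zero_or_pos (periodExponent B P S j q) with h0 | h0
  · rw [h0]; exact zero_le
  obtain ⟨m, hm, -, hdvd⟩ := exists_pow_dvd_of_pow_dvd_period hB (P := P) (S := S) (j := j)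
    ⟨j, le_rfl, hq⟩ h0.ne' (pow_multiplicity_dvd q _)
  refine le_iInf₂ fun v hv => ?_
  have hv' : ∀ m ∈ M, ¬ q ^ (v + 1) ∣ m := hv
  by_contra hlt
  have : v + 1 ≤ periodExponent B P S j q := by
    rw [not_le] at hlt
    exact_mod_cast hlt
  exact hv' m (hS m hm) ((pow_dvd_pow q this).trans hdvd)

end Period

/-! ### Euler products over exponents and over tuples of exponents. -/

/-- Expanding the right side gives one term for each choice of local data. Each `x` is determined by
its local data, and the unused terms are nonnegative. -/
theorem sum_prod_le_prod_sum {α β ι : Type*} (X : Finset α) (K : Finset ι) (e : α → ι → β)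
    (t : ι → Finset β) (F : ι → β → ℝ) (hF : ∀ q b, 0 ≤ F q b)
    (ht : ∀ x ∈ X, ∀ q ∈ K, e x q ∈ t q)
    (hinj : ∀ x ∈ X, ∀ y ∈ X, (∀ q ∈ K, e x q = e y q) → x = y) :
    ∑ x ∈ X, ∏ q ∈ K, F q (e x q) ≤ ∏ q ∈ K, ∑ b ∈ t q, F q b := by
  classical
  let e' : α → (K → β) := fun x q => e x q
  have hinj' : Set.InjOn e' X := fun x hx y hy hxy =>
    hinj x hx y hy fun q hq => congrFun hxy ⟨q, hq⟩
  calc ∑ x ∈ X, ∏ q ∈ K, F q (e x q)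
      = ∑ x ∈ X, ∏ q : K, F q (e' x q) := Finset.sum_congr rfl fun x _ =>
        (Finset.prod_coe_sort K fun q => F q (e x q)).symm
    _ = ∑ p ∈ X.image e', ∏ q : K, F q (p q) := by
        rw [Finset.sum_image hinj']
    _ ≤ ∑ p ∈ Fintype.piFinset (fun q : K => t q), ∏ q : K, F q (p q) := by
        refine Finset.sum_le_sum_of_subset_of_nonneg ?_ fun p _ _ =>
          Finset.prod_nonneg fun q _ => hF _ _
        intro p hp
        obtain ⟨x, hx, rfl⟩ := Finset.mem_image.1 hp
        exact Fintype.mem_piFinset.2 fun q => ht x hx q q.2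
    _ = ∏ q : K, ∑ b ∈ t q, F q b := (Finset.prod_univ_sum _ _).symm
    _ = ∏ q ∈ K, ∑ b ∈ t q, F q b := Finset.prod_coe_sort K fun q => ∑ b ∈ t q, F q b

/-- Exactly `(j + 1) ^ k - j ^ k` of the `k`-tuples have maximum `j`. For `k = 0` the empty tuple
has supremum `0` while the right side vanishes. -/
theorem sum_piFinset_sup {k : ℕ} (hk : 0 < k) (f : ℕ → ℝ) (E : ℕ) :
    ∑ p ∈ Fintype.piFinset (fun _ : Fin k => Finset.range (E + 1)), f (Finset.univ.sup p) =
      ∑ j ∈ Finset.range (E + 1), (((j : ℝ) + 1) ^ k - (j : ℝ) ^ k) * f j := by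
  classical
  have hmem : ∀ (n : ℕ) (p : Fin k → ℕ),
      p ∈ Fintype.piFinset (fun _ : Fin k => Finset.range (n + 1)) ↔ Finset.univ.sup p ≤ n := by
    intro n p
    simp [Fintype.mem_piFinset, Finset.sup_le_iff]
  induction E with
  | zero =>
    rw [Finset.sum_congr rfl fun p hp => by rw [Nat.le_zero.1 ((hmem 0 p).1 hp)]]
    simp [hk.ne']
  | succ E ih =>
    have hsub : Fintype.piFinset (fun _ : Fin k => Finset.range (E + 1)) ⊆
        Fintype.piFinset (fun _ : Fin k => Finset.range (E + 1 + 1)) := fun p hp =>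
      (hmem _ _).2 (((hmem _ _).1 hp).trans (Nat.le_succ E))
    rw [← Finset.sum_sdiff hsub, ih, Finset.sum_range_succ _ (E + 1), add_comm]
    congr 1
    have hval : ∀ p ∈ Fintype.piFinset (fun _ : Fin k => Finset.range (E + 1 + 1)) \
        Fintype.piFinset (fun _ : Fin k => Finset.range (E + 1)),
        f (Finset.univ.sup p) = f (E + 1) := fun p hp => by
      rw [Finset.mem_sdiff, hmem, hmem] at hp
      rw [show Finset.univ.sup p = E + 1 by omega]
    rw [Finset.sum_congr rfl hval, Finset.sum_const, nsmul_eq_mul,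
      Finset.card_sdiff_of_subset hsub, Nat.cast_sub (Finset.card_le_card hsub)]
    simp [Fintype.card_piFinset]

open scoped Classical in
/-- The divisors of `Q` that are factorized by `B`. -/
def baseDivisors (B : Set ℕ) (Q : ℕ) : Finset ℕ := Q.divisors.filter (Factorizes B)

theorem mem_baseDivisors {B : Set ℕ} {Q m : ℕ} (hQ : 0 < Q) :
    m ∈ baseDivisors B Q ↔ m ∣ Q ∧ Factorizes B m := by
  simp [baseDivisors, hQ.ne']

/-- Tuples are grouped by their lcm; if it divides `Q`, so does every entry, which makes the count
in `lcmCount` finite. -/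
theorem sum_lcmCount_mul (B : Set ℕ) {Q : ℕ} (hQ : 0 < Q) (k : ℕ) (g : ℕ → ℝ) :
    ∑ m ∈ Q.divisors, (lcmCount B k m : ℝ) * g m =
      ∑ t ∈ Fintype.piFinset (fun _ : Fin k => baseDivisors B Q), g (Finset.univ.lcm t) := by
  classical
  have hmaps : ∀ t ∈ Fintype.piFinset (fun _ : Fin k => baseDivisors B Q),
      Finset.univ.lcm t ∈ Q.divisors := fun t ht =>
    Nat.mem_divisors.2 ⟨Finset.lcm_dvd fun l _ =>
      ((mem_baseDivisors hQ).1 (Fintype.mem_piFinset.1 ht l)).1, hQ.ne'⟩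
  rw [← Finset.sum_fiberwise_of_maps_to hmaps]
  refine Finset.sum_congr rfl fun m hm => ?_
  rw [Finset.sum_congr rfl fun t ht => by rw [(Finset.mem_filter.1 ht).2], Finset.sum_const,
    nsmul_eq_mul]
  congr 2
  rw [lcmCount, Nat.subtype_card]
  intro t
  rw [Finset.mem_filter, Fintype.mem_piFinset]
  refine and_congr_left fun h => forall_congr' fun l => ?_
  rw [mem_baseDivisors hQ]
  refine and_iff_right ?_
  exact (Finset.dvd_lcm (Finset.mem_univ l)).trans (h ▸ (Nat.mem_divisors.1 hm).1)

/-- The weight `exp lam / q ^ j` of the exponent `j`, which is `1` for `j = 0`. -/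
def expWeight (lam : ℝ) (q j : ℕ) : ℝ := if j = 0 then 1 else Real.exp lam / (q : ℝ) ^ j

theorem expWeight_nonneg (lam : ℝ) (q j : ℕ) : 0 ≤ expWeight lam q j := by
  unfold expWeight
  split_ifs <;> positivity

section Weight

variable {B : Set ℕ} (hB : IsBase B) {K : Finset ℕ} (hK : (K : Set ℕ) ⊆ B)

include hB hK

theorem Factorizes.pow_dvd_iff {n q : ℕ} (hn : Factorizes (K : Set ℕ) n) (hq : q ∈ K) (e : ℕ) :
    q ^ e ∣ n ↔ e ≤ multiplicity q n :=
  (hB.finiteMultiplicity (hK hq) (Factorizes.pos hB hK hn)).pow_dvd_iff_le_multiplicity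

theorem Factorizes.dvd_iff_multiplicity_ne_zero {n q : ℕ} (hn : Factorizes (K : Set ℕ) n)
    (hq : q ∈ K) : q ∣ n ↔ multiplicity q n ≠ 0 := by
  rw [← Nat.pos_iff_ne_zero, ← Nat.succ_le_iff, ← Factorizes.pow_dvd_iff hB hK hn hq, pow_one]

theorem baseOmega_eq_card {n : ℕ} (hn : Factorizes (K : Set ℕ) n) :
    baseOmega B n = (K.filter (fun q => q ∣ n)).card := by
  rw [baseOmega, ← Set.ncard_coe_finset]
  congr 1
  ext q
  simp only [Set.mem_ofPred_eq, Finset.coe_filter]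
  refine ⟨fun ⟨hq, hd⟩ => ⟨?_, hd⟩, fun ⟨hq, hd⟩ => ⟨hK hq, hd⟩⟩
  by_contra hqK
  have h := (hB.finiteMultiplicity hq
    (Factorizes.pos hB hK hn)).pow_dvd_iff_le_multiplicity (k := 1)
  rw [Factorizes.multiplicity_eq_zero hB hK hn hq hqK, pow_one] at h
  exact absurd (h.1 hd) (by norm_num)

/-- The weight is multiplicative: each base element that divides `n` contributes one factor `exp
lam`, whatever its exponent. -/
theorem prod_expWeight {lam : ℝ} {n : ℕ} (hn : Factorizes (K : Set ℕ) n) :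
    ∏ q ∈ K, expWeight lam q (multiplicity q n) =
      Real.exp (lam * (baseOmega B n : ℝ)) / (n : ℝ) := by
  have h1 : ∀ q ∈ K, expWeight lam q (multiplicity q n) =
      (if q ∣ n then Real.exp lam else 1) / (q : ℝ) ^ multiplicity q n := by
    intro q hq
    have h := Factorizes.dvd_iff_multiplicity_ne_zero hB hK hn hq
    unfold expWeight
    by_cases h0 : multiplicity q n = 0
    · rw [if_pos h0, if_neg (by rw [h]; simpa using h0), h0]; simp
    · rw [if_neg h0, if_pos (h.2 h0)]
  rw [Finset.prod_congr rfl h1, Finset.prod_div_distrib]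
  congr 1
  · rw [Finset.prod_ite, Finset.prod_const, Finset.prod_const_one, mul_one,
      ← baseOmega_eq_card hB hK hn, ← Real.exp_nat_mul, mul_comm]
  · conv_rhs => rw [Factorizes.eq_prod hB hK hn]
    push_cast
    rfl

/-- The sum of the weights over numbers with prescribed sets of exponents. -/
theorem sum_weight_le {lam : ℝ} (X : Finset ℕ) (hX : ∀ n ∈ X, Factorizes (K : Set ℕ) n)
    (t : ℕ → Finset ℕ) (ht : ∀ n ∈ X, ∀ q ∈ K, multiplicity q n ∈ t q) :
    ∑ n ∈ X, Real.exp (lam * (baseOmega B n : ℝ)) / (n : ℝ) ≤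
      ∏ q ∈ K, ∑ j ∈ t q, expWeight lam q j := by
  rw [Finset.sum_congr rfl fun n hn => (prod_expWeight hB hK (hX n hn)).symm]
  refine sum_prod_le_prod_sum X K (fun n q => multiplicity q n) t _ (expWeight_nonneg lam) ht
    fun x hx y hy h => ?_
  rw [Factorizes.eq_prod hB hK (hX x hx), Factorizes.eq_prod hB hK (hX y hy)]
  exact Finset.prod_congr rfl fun q hq => by rw [h q hq]

/-- The exponent of `q` in the lcm is the maximum over the tuple, so the weight is again a product
over `q`, and the local sums count tuples by their maximum. -/
theorem sum_weight_lcm_le {lam : ℝ} {k : ℕ} (hk : 0 < k) (X : Finset (Fin k → ℕ))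
    (hX : ∀ t ∈ X, ∀ l, Factorizes (K : Set ℕ) (t l))
    (E : ℕ → ℕ) (hE : ∀ t ∈ X, ∀ l, ∀ q ∈ K, multiplicity q (t l) ≤ E q) :
    ∑ t ∈ X, Real.exp (lam * (baseOmega B (Finset.univ.lcm t) : ℝ)) /
        ((Finset.univ.lcm t : ℕ) : ℝ) ≤
      ∏ q ∈ K, ∑ j ∈ Finset.range (E q + 1),
        (((j : ℝ) + 1) ^ k - (j : ℝ) ^ k) * expWeight lam q j := by
  have hl : ∀ t ∈ X, Factorizes (K : Set ℕ) (Finset.univ.lcm t) ∧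
      ∀ q ∈ B, multiplicity q (Finset.univ.lcm t) =
        Finset.univ.sup (fun l => multiplicity q (t l)) := fun t ht =>
    Factorizes.finset_lcm hB hK Finset.univ t fun l _ => hX t ht l
  have h1 : ∀ t ∈ X, Real.exp (lam * (baseOmega B (Finset.univ.lcm t) : ℝ)) /
        ((Finset.univ.lcm t : ℕ) : ℝ) =
      ∏ q ∈ K, expWeight lam q (Finset.univ.sup (fun l => multiplicity q (t l))) := by
    intro t ht
    rw [← prod_expWeight hB hK (hl t ht).1]
    exact Finset.prod_congr rfl fun q hq => by rw [(hl t ht).2 q (hK hq)]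
  rw [Finset.sum_congr rfl h1]
  simp only [← sum_piFinset_sup hk]
  refine sum_prod_le_prod_sum X K (fun t q l => multiplicity q (t l)) _
    (fun q p => expWeight lam q (Finset.univ.sup p)) (fun q p => expWeight_nonneg _ _ _) ?_ ?_
  · intro t ht q hq
    exact Fintype.mem_piFinset.2 fun l => Finset.mem_range.2 (Nat.lt_succ_of_le (hE t ht l q hq))
  · intro x hx y hy h
    ext l
    rw [Factorizes.eq_prod hB hK (hX x hx l), Factorizes.eq_prod hB hK (hX y hy l)]
    exact Finset.prod_congr rfl fun q hq => by rw [congrFun (h q hq) l]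

end Weight

theorem summable_succ_pow_sub_pow_div {q : ℕ} (hq : 1 < q) (k : ℕ) :
    Summable (fun j : ℕ => (((j : ℝ) + 1) ^ k - (j : ℝ) ^ k) / (q : ℝ) ^ j) := by
  have hq' : (1 : ℝ) < q := by exact_mod_cast hq
  have hr : ‖(q : ℝ)⁻¹‖ < 1 := by
    rw [norm_inv, Real.norm_natCast]
    exact inv_lt_one_of_one_lt₀ hq'
  have h0 := summable_pow_mul_geometric_of_norm_lt_one k hr
  have h1 := ((summable_nat_add_iff 1).2 h0).mul_left (q : ℝ)
  refine (h1.sub h0).congr fun j => ?_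
  have : (q : ℝ) ≠ 0 := by positivity
  push_cast
  rw [inv_pow, inv_pow, pow_succ, sub_div]
  field_simp

/-- A partial sum of a nonnegative series; summability is essential because `tsum` defaults to `0`
otherwise. -/
theorem sum_le_powerSum {M : Set ℕ} {q E : ℕ} (hE : (E : ℕ∞) ≤ maxExponent M q) {c : ℕ → ℝ}
    (hc : ∀ j, 0 ≤ c j) (hs : Summable (fun j : ℕ => c j / (q : ℝ) ^ j)) :
    ∑ j ∈ Finset.Icc 1 E, c j / (q : ℝ) ^ j ≤ powerSum M q c := by
  classical
  unfold powerSum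
  have hnn : ∀ j : ℕ, 0 ≤ c j / (q : ℝ) ^ j := fun j => div_nonneg (hc j) (by positivity)
  have hs' : Summable (fun j : ℕ => if 1 ≤ j ∧ (j : ℕ∞) ≤ maxExponent M q then
      c j / (q : ℝ) ^ j else 0) := by
    refine Summable.of_nonneg_of_le (fun j => ?_) (fun j => ?_) hs
    · split_ifs
      exacts [hnn j, le_rfl]
    · split_ifs
      exacts [le_rfl, hnn j]
  refine le_trans (le_of_eq (Finset.sum_congr rfl fun j hj => ?_))
    (hs'.sum_le_tsum (Finset.Icc 1 E) fun j _ => ?_)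
  · rw [Finset.mem_Icc] at hj
    rw [if_pos ⟨hj.1, le_trans (by exact_mod_cast hj.2) hE⟩]
  · split_ifs
    exacts [hnn j, le_rfl]

theorem sum_range_expWeight (lam : ℝ) (q E : ℕ) {c : ℕ → ℝ} (hc : c 0 = 1) :
    ∑ j ∈ Finset.range (E + 1), c j * expWeight lam q j =
      1 + Real.exp lam * ∑ j ∈ Finset.Icc 1 E, c j / (q : ℝ) ^ j := by
  rw [Finset.range_eq_Ico, Finset.sum_eq_sum_Ico_succ_bot (Nat.succ_pos E), hc, expWeight,
    if_pos rfl, mul_one, Finset.mul_sum]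
  congr 1
  refine Finset.sum_congr (by ext; simp) fun j hj => ?_
  rw [Finset.mem_Icc] at hj
  rw [expWeight, if_neg (by omega)]
  ring

/-! ### One sieving step: fibers, the local lemma on a fiber, and the new measure. -/

section Step

variable {B : Set ℕ} {P : ℕ → ℝ} {S : Finset ℕ} {a : ℕ → ℤ}

theorem isUnionOfClasses_uncovered (hS0 : ∀ m ∈ S, m ≠ 0) (j : ℕ) :
    IsUnionOfClasses (period B P S j) (uncovered B P S a j) := by
  classical
  intro x y hxy hx m hm hy
  have hm' := Finset.mem_filter.1 hm
  refine hx m hm ((hxy.of_dvd ?_).trans hy)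
  exact_mod_cast dvd_period hm'.1 (hS0 m hm'.1) dvd_rfl hm'.2

theorem isUnionOfClasses_sievedOut (j n : ℕ) (r : ℤ) :
    IsUnionOfClasses (period B P S j * n) (sievedOut B P S a j n r) := by
  rintro x y hxy ⟨hx, m, hm, hmn, hxm⟩
  refine ⟨(hxy.symm.of_dvd (by push_cast; exact dvd_mul_right _ _)).trans hx, m, hm, hmn,
    (hxy.symm.of_dvd ?_).trans hxm⟩
  exact_mod_cast mul_dvd_mul_right hm n

theorem sievedOut_congr {j n : ℕ} {r s : ℤ} (h : r ≡ s [ZMOD period B P S j]) :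
    sievedOut B P S a j n r = sievedOut B P S a j n s := by
  ext x
  exact and_congr_left fun _ => ⟨fun hx => hx.trans h, fun hx => hx.trans h.symm⟩

theorem IsGood.congr {lam : ℝ} {j : ℕ} {r s : ℤ} (h : r ≡ s [ZMOD period B P S j])
    (hr : IsGood B P S a lam j r) : IsGood B P S a lam j s := by
  intro q hq
  simpa only [sievedOut_congr h] using hr q hq

variable (hB : IsBase B) (hP : Monotone P)

include hB hP

theorem dvd_newPeriod {j n : ℕ} (hn : n ∣ period B P S (j + 1))
    (hf : Factorizes (block B P (j + 1) : Set ℕ) n) : n ∣ newPeriod B P S (j + 1) := by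
  rw [period_succ hB hP] at hn
  exact (Factorizes.coprime hB (blocksUpTo_subset j) (block_subset _)
    (disjoint_blocksUpTo_block hP j) (period_factorizes hB j) hf).symm.dvd_of_dvd_mul_left hn

omit hP in
theorem multiplicity_le_periodExponent {j n q : ℕ} (hn : n ∣ period B P S j)
    (hq : q ∈ block B P j) :
    multiplicity q n ≤ periodExponent B P S j q := by
  rw [periodExponent, ← (hB.finiteMultiplicity (block_subset j (Finset.mem_coe.2 hq))
    (period_pos hB j)).pow_dvd_iff_le_multiplicity]
  exact (pow_multiplicity_dvd q n).trans hn

omit hP in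
theorem dvd_prod_filter {j n : ℕ} (hn : n ∣ period B P S j)
    (hf : Factorizes (block B P j : Set ℕ) n) :
    n ∣ ∏ q ∈ (block B P j).filter (fun q => q ∣ n), q ^ periodExponent B P S j q := by
  classical
  have h1 := Factorizes.eq_prod hB (block_subset j) hf
  rw [← Finset.prod_filter_of_ne (p := fun q => q ∣ n)] at h1
  · nth_rewrite 1 [h1]
    refine Finset.prod_dvd_prod_of_dvd _ _ fun q hq => pow_dvd_pow q ?_
    exact multiplicity_le_periodExponent hB hn (Finset.mem_filter.1 hq).1
  · intro q hq hne
    rw [Factorizes.dvd_iff_multiplicity_ne_zero hB (block_subset j) hf hq]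
    intro h0
    rw [h0, pow_zero] at hne
    exact hne rfl

/-- The part sieved out by the new factor `n`, in the coordinate of the fiber over `r`. -/
def fiberSieved (B : Set ℕ) (P : ℕ → ℝ) (S : Finset ℕ) (a : ℕ → ℤ) (j : ℕ) (r : ℤ) (n : ℕ) :
    Set ℤ :=
  {y | r + period B P S j * y ∈ sievedOut B P S a j n r}

/-- The uncovered part of the fiber over `r`, in the coordinate of the fiber. -/
def fiberUncovered (B : Set ℕ) (P : ℕ → ℝ) (S : Finset ℕ) (a : ℕ → ℤ) (j : ℕ) (r : ℤ) : Set ℤ :=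
  {y | r + period B P S j * y ∈ uncovered B P S a (j + 1)}

omit hB hP in
theorem isUnionOfClasses_fiber {j N : ℕ} {A : Set ℤ} (r : ℤ)
    (hA : IsUnionOfClasses (period B P S j * N) A) :
    IsUnionOfClasses N {y | r + period B P S j * y ∈ A} := by
  intro x y hxy hx
  refine hA _ _ ?_ hx
  push_cast
  exact Int.ModEq.add_left _ (Int.ModEq.mul_left' hxy)

/-- Goodness counts classes modulo `n * Q_j`, while the local lemma uses densities. The sieved set
has period `n` in the fiber coordinate, so its density is the count divided by `n`. -/
theorem resMean_fiberSieved {j n : ℕ} (hn : n ∣ period B P S (j + 1))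
    (hf : Factorizes (block B P (j + 1) : Set ℕ) n) (r : ℤ) :
    resMean (newPeriod B P S (j + 1)) ((fiberSieved B P S a j r n).indicator 1) =
      (classCount (n * period B P S j) (sievedOut B P S a j n r) : ℝ) / n := by
  rw [fiberSieved, resMean_eq_of_dvd (newPeriod_pos hB _) (dvd_newPeriod hB hP hn hf)
    (isUnionOfClasses_fiber r (isUnionOfClasses_sievedOut j n r)).indicator_one,
    classCount_eq_resSum, mul_comm n, resSum_fiber (period_pos hB j)
    (Factorizes.pos hB (block_subset _) hf)
    (isUnionOfClasses_sievedOut j n r).indicator_one r]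
  · rfl
  · intro x hx
    exact Set.indicator_of_notMem (fun h => hx h.1) _

omit hP in
theorem mem_newFactors {j n : ℕ} : n ∈ newFactors B P S j ↔
    n ∣ period B P S j ∧ 1 < n ∧ Factorizes (block B P j : Set ℕ) n := by
  simp [newFactors, (period_pos (P := P) (S := S) hB j).ne']

/-- The base elements of the block of index `j` that divide `n`. -/
def blockSupport (B : Set ℕ) (P : ℕ → ℝ) (j n : ℕ) : Finset ℕ :=
  (block B P j).filter (fun q => q ∣ n)

omit hP in
-- Each modulus available at step `j + 1` is `m * n` with `m` over the old blocks and `n` over the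
-- new one. If `n = 1` it was already avoided, as `r` lies in `R_j`; if `n > 1` it belongs to the
-- event of the new factor `n`.
theorem fiberUncovered_eq_avoid (hS0 : ∀ m ∈ S, m ≠ 0) {j : ℕ} {r : ℤ}
    (hr : r ∈ uncovered B P S a j) :
    fiberUncovered B P S a j r = avoid (newFactors B P S (j + 1)) (fiberSieved B P S a j r)
      (blockSupport B P (j + 1)) (block B P (j + 1)) := by
  classical
  ext y
  constructor
  · rintro hy n - - ⟨-, m, -, hmn, hym⟩
    exact hy (m * n) hmn hym
  · intro hy m' hm' hym
    have hm'' := Finset.mem_filter.1 hm'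
    have hfac := hm''.2
    rw [blocksUpTo_succ] at hfac
    obtain ⟨m, n, hm, hn, rfl⟩ := hfac.split
    have h0 := hS0 _ hm''.1
    have hmQ : m ∣ period B P S j := dvd_period hm''.1 h0 (dvd_mul_right m n) hm
    have hpos : 0 < n := Factorizes.pos hB (block_subset _) hn
    rcases (Nat.one_le_iff_ne_zero.2 hpos.ne').eq_or_lt with h1 | h1
    · subst h1
      rw [mul_one] at hym hm''
      refine hr m (Finset.mem_filter.2 ⟨hm''.1, hm⟩) (Int.ModEq.trans ?_ hym)
      have hdvd : (m : ℤ) ∣ period B P S j * y :=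
        (Int.natCast_dvd_natCast.2 hmQ).trans (dvd_mul_right _ _)
      rw [Int.modEq_iff_dvd]
      simpa using hdvd
    · refine hy n ((mem_newFactors hB).2 ⟨?_, h1, hn⟩) (Finset.filter_subset _ _)
        ⟨?_, m, hmQ, hm', hym⟩
      · exact dvd_period hm''.1 h0 (dvd_mul_left n m)
          (hn.mono (by rw [blocksUpTo_succ]; exact Set.subset_union_right))
      · simp [Int.ModEq]

variable {lam : ℝ}

omit hP in
theorem isUnionOfClasses_fiberSieved {j n : ℕ} (hn : n ∈ newFactors B P S (j + 1)) (r : ℤ) :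
    IsUnionOfClasses (∏ q ∈ blockSupport B P (j + 1) n, q ^ periodExponent B P S (j + 1) q)
      (fiberSieved B P S a j r n) := by
  have h := (mem_newFactors hB).1 hn
  exact (isUnionOfClasses_fiber r (isUnionOfClasses_sievedOut j n r)).mono
    (dvd_prod_filter hB h.1 h.2.2)

theorem sum_resMean_fiberSieved_le {j : ℕ} {r : ℤ} (hr : IsGood B P S a lam j r) {q : ℕ}
    (hq : q ∈ block B P (j + 1)) :
    ∑ n ∈ (newFactors B P S (j + 1)).filter (fun n => q ∈ blockSupport B P (j + 1) n),
      resMean (newPeriod B P S (j + 1)) ((fiberSieved B P S a j r n).indicator 1) *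
        Real.exp (lam * ((blockSupport B P (j + 1) n).card : ℝ)) ≤ 1 - Real.exp (-lam) := by
  classical
  refine le_trans (le_of_eq ?_) (hr q hq)
  refine Finset.sum_congr ?_ fun n hn => ?_
  · ext n
    simp [blockSupport, hq]
  · have h := (mem_newFactors hB).1 (Finset.mem_filter.1 hn).1
    rw [resMean_fiberSieved hB hP h.1 h.2.2, baseOmega_eq_card hB (block_subset _) h.2.2,
      div_mul_eq_mul_div]
    rfl

omit hP in
theorem periodFactor_pos (j : ℕ) :
    ∀ q ∈ block B P j, 0 < q ^ periodExponent B P S j q := fun q hq =>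
  pow_pos (zero_lt_one.trans (hB.1 q (block_subset j (Finset.mem_coe.2 hq)))) _

omit hP in
theorem periodFactor_coprime (j : ℕ) : (block B P j : Set ℕ).Pairwise
    (fun p q => Nat.Coprime (p ^ periodExponent B P S j p) (q ^ periodExponent B P S j q)) :=
  fun _ hp _ hq hne => Nat.Coprime.pow _ _ (hB.2 (block_subset j hp) (block_subset j hq) hne)

omit hP in
theorem blockSupport_nonempty {j n : ℕ} (hn : n ∈ newFactors B P S j) :
    (blockSupport B P j n).Nonempty := by
  have h := (mem_newFactors hB).1 hn
  rw [Finset.nonempty_iff_ne_empty]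
  intro he
  have h1 := dvd_prod_filter hB h.1 h.2.2
  change n ∣ ∏ q ∈ blockSupport B P j n, _ at h1
  rw [he, Finset.prod_empty, Nat.dvd_one] at h1
  omega

theorem resMean_fiberUncovered_pos (hS0 : ∀ m ∈ S, m ≠ 0) (hlam : 0 ≤ lam) {j : ℕ} {r : ℤ}
    (hr : r ∈ uncovered B P S a j) (hg : IsGood B P S a lam j r) :
    0 < resMean (newPeriod B P S (j + 1)) ((fiberUncovered B P S a j r).indicator 1) := by
  rw [fiberUncovered_eq_avoid hB hS0 hr]
  exact resMean_avoid_pos (periodFactor_pos hB _) (periodFactor_coprime hB _)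
    (fun n _ => Finset.filter_subset _ _) (fun n hn => blockSupport_nonempty hB hn)
    (fun n hn => isUnionOfClasses_fiberSieved hB hn r) hlam
    fun q hq => sum_resMean_fiberSieved_le hB hP hg hq

theorem resMean_inter_fiberUncovered_le (hS0 : ∀ m ∈ S, m ≠ 0) (hlam : 0 ≤ lam) {j : ℕ} {r : ℤ}
    (hr : r ∈ uncovered B P S a j) (hg : IsGood B P S a lam j r) {n : ℕ}
    (hn : n ∣ newPeriod B P S (j + 1)) (hf : Factorizes (block B P (j + 1) : Set ℕ) n) (b : ℤ) :
    resMean (newPeriod B P S (j + 1))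
        (({y | r + period B P S j * y ≡ b [ZMOD n]} ∩ fiberUncovered B P S a j r).indicator 1) ≤
      Real.exp (lam * (baseOmega B n : ℝ)) / n *
        resMean (newPeriod B P S (j + 1)) ((fiberUncovered B P S a j r).indicator 1) := by
  have hnp : n ∣ period B P S (j + 1) := by
    rw [period_succ hB hP]; exact hn.mul_left _
  have hn0 : 0 < n := Factorizes.pos hB (block_subset _) hf
  have hC : IsUnionOfClasses n {y : ℤ | r + period B P S j * y ≡ b [ZMOD n]} :=
    isUnionOfClasses_fiber r (isUnionOfClasses_modEq (dvd_mul_left n (period B P S j)) b)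
  have hmean : resMean (newPeriod B P S (j + 1))
      ({y : ℤ | r + period B P S j * y ≡ b [ZMOD n]}.indicator 1) = 1 / n := by
    have hp : IsModPeriodic n ({x : ℤ | x ≡ b [ZMOD n]}.indicator (1 : ℤ → ℝ)) :=
      (isUnionOfClasses_modEq dvd_rfl b).indicator_one
    rw [resMean_eq_of_dvd (newPeriod_pos hB _) hn hC.indicator_one, resMean]
    congr 1
    -- `Q_j` is a unit modulo `n`, so the fiber coordinate runs through all classes modulo `n` and
    -- meets that of `b` with density `1 / n`.
    have h1 := resSum_affine hn0 hp (Factorizes.coprime hB (blocksUpTo_subset j) (block_subset _)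
      (disjoint_blocksUpTo_block hP j) (period_factorizes (S := S) hB j) hf) r
    have h2 := resSum_fiber (n := 1) (f := {x : ℤ | x ≡ b [ZMOD n]}.indicator (1 : ℤ → ℝ)) hn0
      one_pos (by rw [mul_one]; exact hp) b fun x hx =>
        Set.indicator_of_notMem (s := {x : ℤ | x ≡ b [ZMOD n]}) hx _
    rw [mul_one] at h2
    refine h1.trans (h2.trans ?_)
    simp [resSum]
  have h := resMean_inter_avoid_le (supp := blockSupport B P (j + 1)) (C := {y : ℤ | r + period B P S j * y ≡ b [ZMOD n]})
    (periodFactor_pos (P := P) (S := S) hB (j + 1))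
    (periodFactor_coprime hB _)
    (fun n _ => Finset.filter_subset _ _)
    (fun n hn => isUnionOfClasses_fiberSieved (a := a) hB hn r) hlam
    (fun q hq => sum_resMean_fiberSieved_le hB hP hg hq)
    (W := blockSupport B P (j + 1) n) (Finset.filter_subset _ _) (hC.mono (dvd_prod_filter hB hnp hf))
  have hcard : baseOmega B n = (blockSupport B P (j + 1) n).card :=
    baseOmega_eq_card hB (block_subset _) hf
  rw [← hcard] at h
  rw [fiberUncovered_eq_avoid hB hS0 hr]
  refine h.trans (le_of_eq ?_)
  change resMean (newPeriod B P S (j + 1)) _ * _ * resMean (newPeriod B P S (j + 1)) _ = _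
  rw [hmean]
  ring

theorem fiber_inter_uncovered_nonempty (hS0 : ∀ m ∈ S, m ≠ 0) (hlam : 0 ≤ lam) {j : ℕ} {r : ℤ}
    (hr : r ∈ uncovered B P S a j) (hg : IsGood B P S a lam j r) :
    ({x : ℤ | x ≡ r [ZMOD period B P S j]} ∩ uncovered B P S a (j + 1)).Nonempty := by
  have h := resMean_fiberUncovered_pos hB hP hS0 hlam hr hg
  by_contra hne
  rw [Set.not_nonempty_iff_eq_empty] at hne
  have : fiberUncovered B P S a j r = ∅ := by
    refine Set.eq_empty_of_forall_notMem fun y hy => ?_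
    have : r + period B P S j * y ∈
        ({x : ℤ | x ≡ r [ZMOD period B P S j]} ∩ uncovered B P S a (j + 1)) :=
      ⟨by simp [Int.ModEq], hy⟩
    rw [hne] at this
    exact this
  rw [this] at h
  simp [resMean, resSum] at h

/-- The number of uncovered classes in the fiber over `r`. -/
theorem classCount_fiber (hS0 : ∀ m ∈ S, m ≠ 0) (j : ℕ) (r : ℤ) :
    (classCount (period B P S (j + 1))
      (uncovered B P S a (j + 1) ∩ {x | x ≡ r [ZMOD period B P S j]}) : ℝ) =
      resSum (newPeriod B P S (j + 1)) ((fiberUncovered B P S a j r).indicator 1) := by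
  have hu : IsUnionOfClasses (period B P S j * newPeriod B P S (j + 1))
      (uncovered B P S a (j + 1) ∩ {x | x ≡ r [ZMOD period B P S j]}) := by
    rw [← period_succ hB hP]
    exact (isUnionOfClasses_uncovered hS0 _).inter
      (isUnionOfClasses_modEq (period_dvd_period_succ j) r)
  rw [classCount_eq_resSum, period_succ hB hP, resSum_fiber (period_pos hB j)
    (newPeriod_pos hB _) hu.indicator_one r fun x hx =>
      Set.indicator_of_notMem (fun h => hx h.2) _]
  refine congrArg _ (funext fun y => ?_)
  classical
  simp [Set.indicator_apply, fiberUncovered, Int.ModEq]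

omit hB hP in
theorem nextMeasure_periodic (hS0 : ∀ m ∈ S, m ≠ 0) {j : ℕ} {μ : ℤ → ℝ} {T : Set ℤ}
    (hμ : IsModPeriodic (period B P S j) μ) (hT : IsUnionOfClasses (period B P S j) T) :
    IsModPeriodic (period B P S (j + 1)) (nextMeasure B P S a j μ T) := by
  intro x y hxy
  have hxy' : x ≡ y [ZMOD period B P S j] :=
    hxy.of_dvd (by exact_mod_cast period_dvd_period_succ j)
  have h1 : x ∈ T ∩ uncovered B P S a (j + 1) ↔ y ∈ T ∩ uncovered B P S a (j + 1) :=
    and_congr (hT.mem_iff hxy') ((isUnionOfClasses_uncovered hS0 _).mem_iff hxy)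
  have h2 : {z : ℤ | z ≡ x [ZMOD period B P S j]} = {z : ℤ | z ≡ y [ZMOD period B P S j]} :=
    Set.ext fun z => ⟨fun h => Int.ModEq.trans h hxy', fun h => Int.ModEq.trans h hxy'.symm⟩
  simp only [nextMeasure, h2, hμ x y hxy']
  by_cases hx : x ∈ T ∩ uncovered B P S a (j + 1)
  · rw [if_pos hx, if_pos (h1.1 hx)]
  · rw [if_neg hx, if_neg fun hy => hx (h1.2 hy)]

omit hB hP in
theorem nextMeasure_nonneg {j : ℕ} {μ : ℤ → ℝ} {T : Set ℤ} (hμ : ∀ x, 0 ≤ μ x) (x : ℤ) :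
    0 ≤ nextMeasure B P S a j μ T x := by
  unfold nextMeasure
  split_ifs
  exacts [div_nonneg (hμ x) (Nat.cast_nonneg _), le_rfl]

/-- The mass that the new measure gives to the part in `F` of the fiber over `r`. -/
theorem resSum_fiber_nextMeasure (hS0 : ∀ m ∈ S, m ≠ 0) {j : ℕ} {μ : ℤ → ℝ} {T : Set ℤ}
    (hμ : IsModPeriodic (period B P S j) μ) (hT : IsUnionOfClasses (period B P S j) T)
    (F : Set ℤ) (r : ℤ) :
    resSum (newPeriod B P S (j + 1))
        (fun y => F.indicator (nextMeasure B P S a j μ T) (r + period B P S j * y)) =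
      T.indicator μ r *
        (resMean (newPeriod B P S (j + 1))
          (({y | r + period B P S j * y ∈ F} ∩ fiberUncovered B P S a j r).indicator 1) /
        resMean (newPeriod B P S (j + 1)) ((fiberUncovered B P S a j r).indicator 1)) := by
  classical
  have hN : (newPeriod B P S (j + 1) : ℝ) ≠ 0 := by exact_mod_cast (newPeriod_pos hB _).ne'
  rw [resMean, resMean, div_div_div_cancel_right₀ hN, ← classCount_fiber hB hP hS0,
    ← mul_div_assoc, mul_div_right_comm, ← resSum_const_mul]
  refine congrArg _ (funext fun y => ?_)
  have hry : r + period B P S j * y ≡ r [ZMOD period B P S j] := by simp [Int.ModEq]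
  by_cases hF : r + period B P S j * y ∈ F <;> by_cases hrT : r ∈ T <;>
  by_cases hu : r + period B P S j * y ∈ uncovered B P S a (j + 1) <;>
  simp [nextMeasure, fiberUncovered, hF, hT.mem_iff hry, hrT, hu, hμ _ _ hry]

theorem mass_nextMeasure (hS0 : ∀ m ∈ S, m ≠ 0) {j : ℕ} {μ : ℤ → ℝ} {T : Set ℤ}
    (hμ : IsModPeriodic (period B P S j) μ) (hT : IsUnionOfClasses (period B P S j) T)
    (F : Set ℤ) :
    mass (period B P S (j + 1)) (nextMeasure B P S a j μ T) F =
      ∑ r ∈ Finset.Ico (0 : ℤ) (period B P S j), T.indicator μ r *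
        (resMean (newPeriod B P S (j + 1))
          (({y | r + period B P S j * y ∈ F} ∩ fiberUncovered B P S a j r).indicator 1) /
        resMean (newPeriod B P S (j + 1)) ((fiberUncovered B P S a j r).indicator 1)) := by
  rw [mass_eq_resSum, period_succ hB hP, resSum_mul]
  exact Finset.sum_congr rfl fun r _ => resSum_fiber_nextMeasure hB hP hS0 hμ hT F r

/-- No mass is lost, because goodness gives every fiber over `T` an uncovered class; an empty fiber
would yield the quotient `0 / 0 = 0`. -/
theorem mass_nextMeasure_univ (hS0 : ∀ m ∈ S, m ≠ 0) (hlam : 0 ≤ lam) {j : ℕ} {μ : ℤ → ℝ}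
    {T : Set ℤ} (hμ : IsModPeriodic (period B P S j) μ)
    (hT : IsUnionOfClasses (period B P S j) T) (hTu : T ⊆ uncovered B P S a j)
    (hTg : ∀ r ∈ T, IsGood B P S a lam j r) :
    mass (period B P S (j + 1)) (nextMeasure B P S a j μ T) Set.univ =
      mass (period B P S j) μ T := by
  rw [mass_nextMeasure hB hP hS0 hμ hT, mass_eq_resSum]
  refine Finset.sum_congr rfl fun r _ => ?_
  by_cases hr : r ∈ T
  · have h := resMean_fiberUncovered_pos hB hP hS0 hlam (hTu hr) (hTg r hr)
    rw [show {y : ℤ | r + period B P S j * y ∈ Set.univ} = Set.univ from rfl, Set.univ_inter,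
      div_self h.ne', mul_one]
  · rw [Set.indicator_of_notMem hr, zero_mul]

/-- The congruence modulo `m` is decided by `r` alone, since `m ∣ Q_j`; the one modulo `n` is an
event in the fiber, which the local lemma bounds. -/
theorem mass_nextMeasure_le (hS0 : ∀ m ∈ S, m ≠ 0) (hlam : 0 ≤ lam) {j : ℕ} {μ : ℤ → ℝ}
    {T : Set ℤ} (hμ : IsModPeriodic (period B P S j) μ) (hμ0 : ∀ x, 0 ≤ μ x)
    (hT : IsUnionOfClasses (period B P S j) T) (hTu : T ⊆ uncovered B P S a j)
    (hTg : ∀ r ∈ T, IsGood B P S a lam j r) {m n : ℕ} (hm : m ∣ period B P S j)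
    (hn : n ∣ newPeriod B P S (j + 1)) (hf : Factorizes (block B P (j + 1) : Set ℕ) n) (b : ℤ) :
    mass (period B P S (j + 1)) (nextMeasure B P S a j μ T)
        {x | x ≡ b [ZMOD ((m * n : ℕ) : ℤ)]} ≤
      Real.exp (lam * (baseOmega B n : ℝ)) / n *
        mass (period B P S j) μ {x | x ≡ b [ZMOD m]} := by
  classical
  rw [mass_nextMeasure hB hP hS0 hμ hT, mass_eq_resSum, resSum, Finset.mul_sum]
  refine Finset.sum_le_sum fun r _ => ?_
  have hw : 0 ≤ Real.exp (lam * (baseOmega B n : ℝ)) / n := by positivity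
  have hrhs : 0 ≤ Real.exp (lam * (baseOmega B n : ℝ)) / n *
      {x : ℤ | x ≡ b [ZMOD m]}.indicator μ r :=
    mul_nonneg hw (Set.indicator_nonneg (fun _ _ => hμ0 _) _)
  by_cases hr : r ∈ T
  · rw [Set.indicator_of_mem hr]
    by_cases hrb : r ≡ b [ZMOD m]
    · rw [Set.indicator_of_mem (show r ∈ {x : ℤ | x ≡ b [ZMOD m]} from hrb), mul_comm]
      refine mul_le_mul_of_nonneg_right ?_ (hμ0 r)
      rw [div_le_iff₀ (resMean_fiberUncovered_pos hB hP hS0 hlam (hTu hr) (hTg r hr))]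
      refine le_trans (resMean_mono (indicator_one_le (Set.inter_subset_inter_left _
        fun y hy => ?_)))
        (resMean_inter_fiberUncovered_le hB hP hS0 hlam (hTu hr) (hTg r hr) hn hf b)
      exact Int.ModEq.of_dvd (by push_cast; exact dvd_mul_left _ _) hy
    · have he : {y : ℤ | r + period B P S j * y ∈ {x : ℤ | x ≡ b [ZMOD ((m * n : ℕ) : ℤ)]}} =
          ∅ := by
        refine Set.eq_empty_of_forall_notMem fun y hy => hrb ?_
        have h1 : r + period B P S j * y ≡ b [ZMOD m] :=
          Int.ModEq.of_dvd (by push_cast; exact dvd_mul_right _ _) hy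
        refine Int.ModEq.trans ?_ h1
        rw [Int.modEq_iff_dvd]
        have hdvd : (m : ℤ) ∣ period B P S j * y :=
          (Int.natCast_dvd_natCast.2 hm).trans (dvd_mul_right _ _)
        simpa using hdvd
      rw [he, Set.empty_inter]
      refine le_trans (le_of_eq ?_) hrhs
      simp [resMean, resSum]
  · rw [Set.indicator_of_notMem hr, zero_mul]
    exact hrhs

end Step

/-! ### Masses, the bias, and moments of class counts. -/

section Mass

variable {Q : ℕ} {μ : ℤ → ℝ}

theorem mass_nonneg (hμ0 : ∀ x, 0 ≤ μ x) (A : Set ℤ) : 0 ≤ mass Q μ A :=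
  Finset.sum_nonneg fun x _ => hμ0 x

theorem mass_eq_univ_of_support {D : Set ℤ} (hD : ∀ x, x ∉ D → μ x = 0) :
    mass Q μ D = mass Q μ Set.univ := by
  rw [mass_eq_resSum, mass_eq_resSum, Set.indicator_univ]
  refine congrArg _ (Set.indicator_eq_self.2 fun x hx => ?_)
  by_contra h
  exact hx (hD x h)

theorem mass_add_mass_diff {A D : Set ℤ} (h : A ⊆ D) :
    mass Q μ A + mass Q μ (D \ A) = mass Q μ D := by
  simp only [mass_eq_resSum, resSum, ← Finset.sum_add_distrib]
  refine Finset.sum_congr rfl fun x _ => ?_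
  by_cases hA : x ∈ A
  · simp [hA, h hA]
  · by_cases hD : x ∈ D <;> simp [hA, hD]

/-- The largest share of the total mass in a class modulo `m`. -/
def maxShare (Q : ℕ) (μ : ℤ → ℝ) (m : ℕ) : ℝ :=
  ⨆ b : Fin m, mass Q μ {x | x ≡ ((b : ℕ) : ℤ) [ZMOD m]} / mass Q μ Set.univ

theorem maxShare_nonneg (hμ0 : ∀ x, 0 ≤ μ x) (m : ℕ) : 0 ≤ maxShare Q μ m :=
  Real.iSup_nonneg fun _ => div_nonneg (mass_nonneg hμ0 _) (mass_nonneg hμ0 _)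

theorem share_le_maxShare {m : ℕ} (hm : 0 < m) (b : ℤ) :
    mass Q μ {x | x ≡ b [ZMOD m]} / mass Q μ Set.univ ≤ maxShare Q μ m := by
  have hm' : (0 : ℤ) < m := by exact_mod_cast hm
  have h0 := Int.emod_nonneg b hm'.ne'
  have h1 := Int.emod_lt_of_pos b hm'
  have hlt : (b % m).toNat < m := by omega
  have h2 : {x : ℤ | x ≡ b [ZMOD m]} =
      {x : ℤ | x ≡ (((⟨(b % m).toNat, hlt⟩ : Fin m) : ℕ) : ℤ) [ZMOD m]} := by
    ext x
    simp only [Set.mem_ofPred_eq, Int.toNat_of_nonneg h0, Int.ModEq, Int.emod_emod]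
  rw [h2]
  exact le_ciSup (f := fun b : Fin m =>
    mass Q μ {x | x ≡ ((b : ℕ) : ℤ) [ZMOD m]} / mass Q μ Set.univ)
    (Set.finite_range _).bddAbove _

theorem maxShare_le {m : ℕ} (hm : 0 < m) {C : ℝ}
    (h : ∀ b : ℤ, mass Q μ {x | x ≡ b [ZMOD m]} / mass Q μ Set.univ ≤ C) :
    maxShare Q μ m ≤ C := by
  have : Nonempty (Fin m) := ⟨⟨0, hm⟩⟩
  exact ciSup_le fun b => h _

theorem bias_nonneg (hμ0 : ∀ x, 0 ≤ μ x) (B : Set ℕ) (k : ℕ) : 0 ≤ bias B Q μ k :=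
  Real.rpow_nonneg (Finset.sum_nonneg fun m _ =>
    mul_nonneg (Nat.cast_nonneg _) (maxShare_nonneg hμ0 m)) _

theorem bias_pow (hμ0 : ∀ x, 0 ≤ μ x) (B : Set ℕ) (hQ : 0 < Q) {k : ℕ} (hk : 0 < k) :
    bias B Q μ k ^ k =
      ∑ t ∈ Fintype.piFinset (fun _ : Fin k => baseDivisors B Q),
        maxShare Q μ (Finset.univ.lcm t) := by
  rw [← sum_lcmCount_mul B hQ, bias, one_div, Real.rpow_inv_natCast_pow _ hk.ne']
  · rfl
  · exact Finset.sum_nonneg fun m _ => mul_nonneg (Nat.cast_nonneg _) (maxShare_nonneg hμ0 m)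

/-- The `k`-th moment of the number of prescribed classes that contain a point is at most the
`k`-th power of the bias. -/
theorem moment_le {B : Set ℕ} (hμ0 : ∀ x, 0 ≤ μ x) (hμ1 : 0 < mass Q μ Set.univ) (hQ : 0 < Q)
    {k : ℕ} (hk : 0 < k) (c : ℕ → ℤ) :
    resSum Q (fun r => μ r *
      (∑ m ∈ baseDivisors B Q, {x : ℤ | x ≡ c m [ZMOD m]}.indicator (1 : ℤ → ℝ) r) ^ k) ≤
      mass Q μ Set.univ * bias B Q μ k ^ k := by
  classical
  rw [bias_pow hμ0 B hQ hk, Finset.mul_sum]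
  have hexp : ∀ r, (∑ m ∈ baseDivisors B Q,
      {x : ℤ | x ≡ c m [ZMOD m]}.indicator (1 : ℤ → ℝ) r) ^ k =
      ∑ t ∈ Fintype.piFinset (fun _ : Fin k => baseDivisors B Q),
        ∏ l, {x : ℤ | x ≡ c (t l) [ZMOD (t l)]}.indicator (1 : ℤ → ℝ) r := by
    intro r
    rw [← Finset.prod_univ_sum (fun _ : Fin k => baseDivisors B Q)
      (fun _ m => {x : ℤ | x ≡ c m [ZMOD m]}.indicator (1 : ℤ → ℝ) r)]
    simp
  simp only [hexp, Finset.mul_sum]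
  rw [resSum_sum]
  refine Finset.sum_le_sum fun t ht => ?_
  have hpos : 0 < Finset.univ.lcm t := Nat.pos_of_dvd_of_pos (Finset.lcm_dvd fun l _ =>
    ((mem_baseDivisors hQ).1 (Fintype.mem_piFinset.1 ht l)).1) hQ
  -- The classes of a tuple have either no common point or, given one common point, exactly its
  -- class modulo the lcm as intersection.
  by_cases hex : ∃ x₀ : ℤ, ∀ l, x₀ ≡ c (t l) [ZMOD (t l)]
  · obtain ⟨x₀, hx₀⟩ := hex
    refine le_trans ?_ ((div_le_iff₀' hμ1).1 (share_le_maxShare hpos x₀))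
    rw [mass_eq_resSum]
    refine resSum_mono fun r => ?_
    by_cases hr : ∀ l, r ≡ c (t l) [ZMOD (t l)]
    · rw [Set.indicator_of_mem, Finset.prod_eq_one, mul_one]
      · exact fun l _ => Set.indicator_of_mem (s := {x : ℤ | x ≡ c (t l) [ZMOD (t l)]}) (hr l) _
      · change r ≡ x₀ [ZMOD _]
        rw [Int.modEq_iff_dvd, Int.natCast_dvd]
        refine Finset.lcm_dvd fun l _ => ?_
        rw [← Int.natCast_dvd, ← Int.modEq_iff_dvd]
        exact (hr l).trans (hx₀ l).symm
    · obtain ⟨l, hl⟩ := not_forall.1 hr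
      rw [Finset.prod_eq_zero (Finset.mem_univ l)
        (Set.indicator_of_notMem (s := {x : ℤ | x ≡ c (t l) [ZMOD (t l)]}) hl _), mul_zero]
      exact Set.indicator_nonneg (fun _ _ => hμ0 _) _
  · refine le_trans (le_of_eq ?_) (mul_nonneg hμ1.le (maxShare_nonneg hμ0 _))
    refine Finset.sum_eq_zero fun r _ => ?_
    obtain ⟨l, hl⟩ := not_forall.1 (not_exists.1 hex r)
    rw [Finset.prod_eq_zero (Finset.mem_univ l)
      (Set.indicator_of_notMem (s := {x : ℤ | x ≡ c (t l) [ZMOD (t l)]}) hl _), mul_zero]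

end Mass

/-- Jensen's inequality for the `k`-th power with the normalized weights `w i / W`; total weight
zero is treated apart. -/
theorem pow_sum_mul_le {ι : Type*} (s : Finset ι) (w z : ι → ℝ) (hw : ∀ i ∈ s, 0 ≤ w i)
    (hz : ∀ i ∈ s, 0 ≤ z i) {k : ℕ} (hk : 0 < k) :
    (∑ i ∈ s, w i * z i) ^ k ≤ (∑ i ∈ s, w i) ^ (k - 1) * ∑ i ∈ s, w i * z i ^ k := by
  rcases (Finset.sum_nonneg hw).eq_or_lt with h0 | h0
  · have h1 := (Finset.sum_eq_zero_iff_of_nonneg hw).1 h0.symm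
    rw [Finset.sum_eq_zero fun i hi => by rw [h1 i hi, zero_mul], zero_pow hk.ne']
    exact mul_nonneg (pow_nonneg (Finset.sum_nonneg hw) _)
      (Finset.sum_nonneg fun i hi => mul_nonneg (hw i hi) (pow_nonneg (hz i hi) _))
  · set W := ∑ i ∈ s, w i with hW
    have h := Real.pow_arith_mean_le_arith_mean_pow s (fun i => w i / W) z
      (fun i hi => div_nonneg (hw i hi) h0.le) (by rw [← Finset.sum_div, div_self h0.ne']) hz k
    have e1 : ∑ i ∈ s, w i / W * z i = (∑ i ∈ s, w i * z i) / W := by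
      rw [Finset.sum_div]; exact Finset.sum_congr rfl fun i _ => by ring
    have e2 : ∑ i ∈ s, w i / W * z i ^ k = (∑ i ∈ s, w i * z i ^ k) / W := by
      rw [Finset.sum_div]; exact Finset.sum_congr rfl fun i _ => by ring
    rw [e1, e2, div_pow, div_le_iff₀ (pow_pos h0 k)] at h
    refine h.trans (le_of_eq ?_)
    obtain ⟨k, rfl⟩ := Nat.exists_eq_succ_of_ne_zero hk.ne'
    rw [Nat.succ_sub_one, pow_succ]
    field_simp

/-! ### Bounds for the sum that defines goodness. -/

section Step

variable {B : Set ℕ} {P : ℕ → ℝ} {S : Finset ℕ} {a : ℕ → ℤ} {M : Set ℕ} {lam : ℝ}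

theorem powerSum_nonneg {q : ℕ} {c : ℕ → ℝ} (hc : ∀ j, 0 ≤ c j) : 0 ≤ powerSum M q c := by
  unfold powerSum
  refine tsum_nonneg fun j => ?_
  split_ifs
  exacts [div_nonneg (hc j) (by positivity), le_rfl]

theorem summable_one_div_pow {q : ℕ} (hq : 1 < q) :
    Summable (fun j : ℕ => (1 : ℝ) / (q : ℝ) ^ j) := by
  refine (summable_succ_pow_sub_pow_div hq 1).congr fun j => ?_
  simp

theorem succ_pow_sub_pow_nonneg (k j : ℕ) : (0 : ℝ) ≤ ((j : ℝ) + 1) ^ k - (j : ℝ) ^ k :=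
  sub_nonneg.2 (pow_le_pow_left₀ (Nat.cast_nonneg j) (by linarith) k)

variable (hB : IsBase B) (hP : Monotone P)

include hB hP

/-- For fixed `m`, the conditions modulo `Q_j` and `m * n` leave at most one class modulo `n * Q_j`,
as `Q_j` and `n` are coprime, and none at all unless `r ≡ a (m * n)` modulo `m`. -/
theorem classCount_sievedOut_le (hS : ∀ m ∈ S, Factorizes B m) {j n : ℕ}
    (hn : n ∈ newFactors B P S (j + 1)) (r : ℤ) :
    (classCount (n * period B P S j) (sievedOut B P S a j n r) : ℝ) ≤
      ∑ m ∈ baseDivisors B (period B P S j),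
        {x : ℤ | x ≡ a (m * n) [ZMOD m]}.indicator (1 : ℤ → ℝ) r := by
  classical
  obtain ⟨hnd, hn1, hf⟩ := (mem_newFactors hB).1 hn
  have hQ := period_pos (P := P) (S := S) hB j
  have hcop : Nat.Coprime (period B P S j) n :=
    Factorizes.coprime hB (blocksUpTo_subset j) (block_subset _)
      (disjoint_blocksUpTo_block hP j) (period_factorizes hB j) hf
  let X : ℕ → Finset ℤ := fun m => (Finset.Ico (0 : ℤ) ((n * period B P S j : ℕ) : ℤ)).filter
    (fun x => x ≡ r [ZMOD period B P S j] ∧ x ≡ a (m * n) [ZMOD ((m * n : ℕ) : ℤ)])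
  have hsub : (Finset.Ico (0 : ℤ) ((n * period B P S j : ℕ) : ℤ)).filter
      (fun x => x ∈ sievedOut B P S a j n r) ⊆
        (baseDivisors B (period B P S j)).biUnion X := by
    intro x hx
    obtain ⟨hx, hxr, m, hm, hmn, hxm⟩ := Finset.mem_filter.1 hx
    refine Finset.mem_biUnion.2 ⟨m, (mem_baseDivisors hQ).2 ⟨hm, ?_⟩,
      Finset.mem_filter.2 ⟨hx, hxr, hxm⟩⟩
    exact Factorizes.of_mul_right hB subset_rfl (hS _ (Finset.mem_filter.1 hmn).1)
      (hf.mono (block_subset _))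
  have hX : ∀ m ∈ baseDivisors B (period B P S j),
      ((X m).card : ℝ) ≤ {x : ℤ | x ≡ a (m * n) [ZMOD m]}.indicator (1 : ℤ → ℝ) r := by
    intro m hm
    have hmQ := ((mem_baseDivisors hQ).1 hm).1
    by_cases hr : r ≡ a (m * n) [ZMOD m]
    · rw [Set.indicator_of_mem (show r ∈ {x : ℤ | x ≡ a (m * n) [ZMOD m]} from hr), Pi.one_apply]
      norm_cast
      rw [Finset.card_le_one]
      intro x hx y hy
      obtain ⟨hx0, hx1, hx2⟩ := Finset.mem_filter.1 hx
      obtain ⟨hy0, hy1, hy2⟩ := Finset.mem_filter.1 hy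
      rw [Finset.mem_Ico] at hx0 hy0
      have hxy1 : x ≡ y [ZMOD period B P S j] := hx1.trans hy1.symm
      have hxy2 : x ≡ y [ZMOD n] :=
        (hx2.trans hy2.symm).of_dvd (by push_cast; exact dvd_mul_left _ _)
      have hxy : x ≡ y [ZMOD ((n * period B P S j : ℕ) : ℤ)] := by
        push_cast
        rw [mul_comm]
        exact (Int.modEq_and_modEq_iff_modEq_mul (by simpa using hcop)).1 ⟨hxy1, hxy2⟩
      rwa [Int.ModEq, Int.emod_eq_of_lt hx0.1 hx0.2, Int.emod_eq_of_lt hy0.1 hy0.2] at hxy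
    · rw [Set.indicator_of_notMem (s := {x : ℤ | x ≡ a (m * n) [ZMOD m]}) hr]
      have : X m = ∅ := by
        refine Finset.eq_empty_of_forall_notMem fun x hx => hr ?_
        obtain ⟨-, hx1, hx2⟩ := Finset.mem_filter.1 hx
        exact (hx1.symm.of_dvd (Int.natCast_dvd_natCast.2 hmQ)).trans
          (hx2.of_dvd (by push_cast; exact dvd_mul_right _ _))
      simp [this]
  refine le_trans ?_ (Finset.sum_le_sum hX)
  have := (Finset.card_le_card hsub).trans Finset.card_biUnion_le
  exact_mod_cast this

omit hP in
theorem sum_range_expWeight_le (hS : ∀ m ∈ S, m ∈ M) {j q : ℕ} (hq : q ∈ block B P j)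
    {c : ℕ → ℝ} (hc0 : c 0 = 1) (hc : ∀ j, 0 ≤ c j)
    (hs : Summable (fun j : ℕ => c j / (q : ℝ) ^ j)) :
    ∑ l ∈ Finset.range (periodExponent B P S j q + 1), c l * expWeight lam q l ≤
      1 + Real.exp lam * powerSum M q c := by
  rw [sum_range_expWeight lam q _ hc0]
  have := mul_le_mul_of_nonneg_left
    (sum_le_powerSum (periodExponent_le_maxExponent hB hS hq) hc hs) (Real.exp_nonneg lam)
  linarith

omit hP in
theorem sum_newFactors_weight_le (hS : ∀ m ∈ S, m ∈ M) {j q : ℕ} (hq : q ∈ block B P j) :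
    ∑ n ∈ (newFactors B P S j).filter (fun n => q ∣ n),
      Real.exp (lam * (baseOmega B n : ℝ)) / (n : ℝ) ≤
      Real.exp lam * powerSum M q (fun _ => 1) *
        ∏ p ∈ block B P j, (1 + Real.exp lam * powerSum M p (fun _ => 1)) := by
  classical
  have hone : ∀ p ∈ block B P j, 1 < p := fun p hp => hB.1 p (block_subset j (Finset.mem_coe.2 hp))
  let E := periodExponent B P S j
  -- Divisibility by `q` excludes exponent `0` at `q`, so the local factor there has no leading `1`;
  -- this makes the bound proportional to `powerSum M q`.
  let t : ℕ → Finset ℕ := fun p => if p = q then Finset.Icc 1 (E p) else Finset.range (E p + 1)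
  have h1 := sum_weight_le (lam := lam) hB (block_subset (P := P) j)
    ((newFactors B P S j).filter (fun n => q ∣ n))
    (fun n hn => ((mem_newFactors hB).1 (Finset.mem_filter.1 hn).1).2.2) t (by
      intro n hn p hp
      obtain ⟨hn, hqn⟩ := Finset.mem_filter.1 hn
      obtain ⟨hnd, -, hf⟩ := (mem_newFactors hB).1 hn
      have hle : multiplicity p n ≤ E p := multiplicity_le_periodExponent hB hnd hp
      simp only [t]
      split_ifs with h
      · subst h
        rw [Finset.mem_Icc]
        refine ⟨Nat.one_le_iff_ne_zero.2 ?_, hle⟩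
        rwa [← Factorizes.dvd_iff_multiplicity_ne_zero hB (block_subset j) hf hp]
      · exact Finset.mem_range.2 (Nat.lt_succ_of_le hle))
  refine h1.trans ?_
  have hps : ∀ p, 0 ≤ powerSum M p (fun _ => 1) := fun p => powerSum_nonneg fun _ => zero_le_one
  have hfac : ∀ p, 1 ≤ 1 + Real.exp lam * powerSum M p (fun _ => 1) := fun p =>
    le_add_of_nonneg_right (mul_nonneg (Real.exp_nonneg _) (hps p))
  rw [← Finset.mul_prod_erase _ _ hq, ← Finset.mul_prod_erase _
    (fun p => 1 + Real.exp lam * powerSum M p (fun _ => 1)) hq]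
  have hq1 : ∑ l ∈ t q, expWeight lam q l ≤ Real.exp lam * powerSum M q (fun _ => 1) := by
    simp only [t, if_true]
    have h2 := sum_range_expWeight lam q (E q) (c := fun _ => 1) rfl
    have h3 := mul_le_mul_of_nonneg_left (sum_le_powerSum
      (periodExponent_le_maxExponent (P := P) hB hS hq) (fun _ => zero_le_one (α := ℝ))
      (summable_one_div_pow (hone q hq))) (Real.exp_nonneg lam)
    refine le_trans (le_of_eq ?_) h3
    rw [Finset.mul_sum]
    refine Finset.sum_congr rfl fun l hl => ?_
    rw [Finset.mem_Icc] at hl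
    rw [expWeight, if_neg (by omega)]
    ring
  have hq2 : ∏ p ∈ (block B P j).erase q, ∑ l ∈ t p, expWeight lam p l ≤
      ∏ p ∈ (block B P j).erase q, (1 + Real.exp lam * powerSum M p (fun _ => 1)) := by
    refine Finset.prod_le_prod (fun p _ => Finset.sum_nonneg fun l _ => expWeight_nonneg _ _ _)
      fun p hp => ?_
    simp only [t, if_neg (Finset.ne_of_mem_erase hp)]
    have := sum_range_expWeight_le (lam := lam) hB hS (Finset.mem_of_mem_erase hp)
      (c := fun _ => 1) rfl (fun _ => zero_le_one)
      (summable_one_div_pow (hone p (Finset.mem_of_mem_erase hp)))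
    simpa using this
  refine mul_le_mul hq1 (hq2.trans ?_) (Finset.prod_nonneg fun p _ =>
    Finset.sum_nonneg fun l _ => expWeight_nonneg _ _ _)
    (mul_nonneg (Real.exp_nonneg _) (hps q))
  -- The missing factor at `q` is at least `1`; restoring it makes the product independent of `q`,
  -- as in the criterion.
  refine le_mul_of_one_le_left (Finset.prod_nonneg fun p _ => ?_) (hfac q)
  exact zero_le_one.trans (hfac p)

end Step

/-! ### Existence of good sets, growth of the bias, and the induction on steps. -/

section Criterion

variable {B : Set ℕ} {P : ℕ → ℝ} {S : Finset ℕ} {a : ℕ → ℤ} {M : Set ℕ} {lam : ℝ}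
  (hB : IsBase B) (hP : Monotone P)

include hB hP

/-- The `k`-th moment of the sum that controls the goodness of a class at the base element `q`. -/
theorem moment_goodness_le (hSM : ∀ m ∈ S, m ∈ M) (hSB : ∀ m ∈ S, Factorizes B m) {j : ℕ}
    {μ : ℤ → ℝ} (hμ0 : ∀ x, 0 ≤ μ x) (hμ1 : 0 < mass (period B P S j) μ Set.univ) {k : ℕ}
    (hk : 0 < k) {q : ℕ} (hq : q ∈ block B P (j + 1)) :
    resSum (period B P S j) (fun r => μ r *
      (∑ n ∈ (newFactors B P S (j + 1)).filter (fun n => q ∣ n),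
        (classCount (n * period B P S j) (sievedOut B P S a j n r) : ℝ) *
          Real.exp (lam * (baseOmega B n : ℝ)) / (n : ℝ)) ^ k) ≤
      (Real.exp lam * powerSum M q (fun _ => 1) *
        ∏ p ∈ block B P (j + 1), (1 + Real.exp lam * powerSum M p (fun _ => 1))) ^ k *
          (mass (period B P S j) μ Set.univ * bias B (period B P S j) μ k ^ k) := by
  classical
  set J := (newFactors B P S (j + 1)).filter (fun n => q ∣ n) with hJ
  set w : ℕ → ℝ := fun n => Real.exp (lam * (baseOmega B n : ℝ)) / (n : ℝ) with hw
  let X : ℕ → ℤ → ℝ := fun n r => ∑ m ∈ baseDivisors B (period B P S j),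
    {x : ℤ | x ≡ a (m * n) [ZMOD m]}.indicator (1 : ℤ → ℝ) r
  have hw0 : ∀ n, 0 ≤ w n := fun n => by positivity
  have hX0 : ∀ n r, 0 ≤ X n r := fun n r => Finset.sum_nonneg fun m _ => indicator_one_nonneg _ _
  have hV : 0 ≤ mass (period B P S j) μ Set.univ * bias B (period B P S j) μ k ^ k :=
    mul_nonneg hμ1.le (pow_nonneg (bias_nonneg hμ0 B k) _)
  -- Jensen over the new factors, with weights `w n`, reduces the moment of the weighted sum to
  -- moments for a single `n`, where `moment_le` applies with the residues `a (m * n)`.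
  have hpt : ∀ r, μ r * (∑ n ∈ J,
        (classCount (n * period B P S j) (sievedOut B P S a j n r) : ℝ) *
          Real.exp (lam * (baseOmega B n : ℝ)) / (n : ℝ)) ^ k ≤
      (∑ n ∈ J, w n) ^ (k - 1) * ∑ n ∈ J, w n * (μ r * X n r ^ k) := by
    intro r
    have h1 : ∑ n ∈ J, (classCount (n * period B P S j) (sievedOut B P S a j n r) : ℝ) *
          Real.exp (lam * (baseOmega B n : ℝ)) / (n : ℝ) ≤ ∑ n ∈ J, w n * X n r := by
      refine Finset.sum_le_sum fun n hn => ?_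
      rw [mul_div_assoc, mul_comm]
      exact mul_le_mul_of_nonneg_left
        (classCount_sievedOut_le hB hP hSB (Finset.mem_filter.1 hn).1 r) (hw0 n)
    have h2 := (pow_le_pow_left₀ (Finset.sum_nonneg fun n _ => by positivity) h1 k).trans
      (pow_sum_mul_le J w (fun n => X n r) (fun n _ => hw0 n) (fun n _ => hX0 n r) hk)
    refine (mul_le_mul_of_nonneg_left h2 (hμ0 r)).trans (le_of_eq ?_)
    rw [mul_left_comm, Finset.mul_sum]
    congr 1
    exact Finset.sum_congr rfl fun n _ => by ring
  refine (resSum_mono hpt).trans ?_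
  rw [resSum_const_mul, resSum_sum]
  have h3 : ∑ n ∈ J, resSum (period B P S j) (fun r => w n * (μ r * X n r ^ k)) ≤
      (∑ n ∈ J, w n) * (mass (period B P S j) μ Set.univ * bias B (period B P S j) μ k ^ k) := by
    rw [Finset.sum_mul]
    refine Finset.sum_le_sum fun n _ => ?_
    rw [resSum_const_mul]
    exact mul_le_mul_of_nonneg_left
      (moment_le hμ0 hμ1 (period_pos hB j) hk fun m => a (m * n)) (hw0 n)
  have hW0 : 0 ≤ ∑ n ∈ J, w n := Finset.sum_nonneg fun n _ => hw0 n
  refine (mul_le_mul_of_nonneg_left h3 (pow_nonneg hW0 _)).trans ?_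
  rw [← mul_assoc, ← pow_succ, Nat.sub_add_cancel hk]
  exact mul_le_mul_of_nonneg_right
    (pow_le_pow_left₀ hW0 (sum_newFactors_weight_le hB hSM hq) k) hV

/-- Markov's inequality for `k`-th moments with a union bound over the new block; the set taken is
the largest candidate, all good classes in `D`. The measure `μ` is not tied to the residues `a`, so
the new residues may be chosen after it. -/
theorem isGoodSet_of_criterion (hSM : ∀ m ∈ S, m ∈ M) (hSB : ∀ m ∈ S, Factorizes B m)
    (hlam : 0 < lam) {piGood : ℝ} (hpi1 : piGood ≤ 1) {j : ℕ} {μ : ℤ → ℝ} (hμ0 : ∀ x, 0 ≤ μ x)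
    (hμ1 : 0 < mass (period B P S j) μ Set.univ) {D : Set ℤ}
    (hD : IsUnionOfClasses (period B P S j) D) (hDμ : ∀ x, x ∉ D → μ x = 0) {k : ℕ}
    (hk : 0 < k)
    (hC : (∏ q ∈ block B P (j + 1), (1 + Real.exp lam * powerSum M q (fun _ => 1))) *
        bias B (period B P S j) μ k *
        (∑ q ∈ block B P (j + 1), powerSum M q (fun _ => 1) ^ k) ^ (1 / (k : ℝ)) ≤
      (1 - Real.exp (-lam)) / Real.exp lam * (1 - piGood) ^ (1 / (k : ℝ))) :
    IsGoodSet B P S a lam piGood j μ D {r | r ∈ D ∧ IsGood B P S a lam j r} := by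
  classical
  refine ⟨fun x y hxy hx => ⟨hD x y hxy hx.1, hx.2.congr hxy⟩, fun x hx => hx.1,
    fun r hr => hr.2, ?_⟩
  set T : Set ℤ := {r | r ∈ D ∧ IsGood B P S a lam j r} with hT
  set Q := period B P S j with hQ
  set V := mass Q μ Set.univ with hV
  set W := ∏ q ∈ block B P (j + 1), (1 + Real.exp lam * powerSum M q (fun _ => 1)) with h_prod
  set β := bias B Q μ k with hβ
  set Z := ∑ q ∈ block B P (j + 1), powerSum M q (fun _ => 1) ^ k with hZ
  set δ := 1 - Real.exp (-lam) with hδ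
  have hδ0 : 0 < δ := by
    rw [hδ, sub_pos, Real.exp_lt_one_iff]
    linarith
  have hps : ∀ p, 0 ≤ powerSum M p (fun _ => 1) := fun p => powerSum_nonneg fun _ => zero_le_one
  have hβ0 : 0 ≤ β := bias_nonneg hμ0 B k
  have h_prod0 : 0 ≤ W := Finset.prod_nonneg fun p _ =>
    add_nonneg zero_le_one (mul_nonneg (Real.exp_nonneg _) (hps p))
  have hZ0 : 0 ≤ Z := Finset.sum_nonneg fun p _ => pow_nonneg (hps p) _
  have hbad : mass Q μ (D \ T) * δ ^ k ≤ V * ((Real.exp lam * W * β) ^ k * Z) := by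
    have h1 : δ ^ k * mass Q μ (D \ T) ≤ resSum Q (fun r => ∑ q ∈ block B P (j + 1), μ r *
        (∑ n ∈ (newFactors B P S (j + 1)).filter (fun n => q ∣ n),
          (classCount (n * Q) (sievedOut B P S a j n r) : ℝ) *
            Real.exp (lam * (baseOmega B n : ℝ)) / (n : ℝ)) ^ k) := by
      rw [mass_eq_resSum, ← resSum_const_mul]
      refine resSum_mono fun r => ?_
      have hF0 : ∀ q, 0 ≤ ∑ n ∈ (newFactors B P S (j + 1)).filter (fun n => q ∣ n),
          (classCount (n * Q) (sievedOut B P S a j n r) : ℝ) *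
            Real.exp (lam * (baseOmega B n : ℝ)) / (n : ℝ) := fun q =>
        Finset.sum_nonneg fun n _ => by positivity
      have hterm : ∀ q ∈ block B P (j + 1), 0 ≤ μ r *
        (∑ n ∈ (newFactors B P S (j + 1)).filter (fun n => q ∣ n),
          (classCount (n * Q) (sievedOut B P S a j n r) : ℝ) *
            Real.exp (lam * (baseOmega B n : ℝ)) / (n : ℝ)) ^ k := fun q _ =>
        mul_nonneg (hμ0 r) (pow_nonneg (hF0 q) k)
      by_cases hr : r ∈ D \ T
      · rw [Set.indicator_of_mem hr, mul_comm]
        have hng : ¬ IsGood B P S a lam j r := fun h => hr.2 ⟨hr.1, h⟩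
        unfold IsGood at hng
        push Not at hng
        obtain ⟨q, hq, hlt⟩ := hng
        -- A bad class violates goodness at some `q`, and the `k`-th power of that one sum already
        -- exceeds `δ ^ k`.
        refine le_trans ?_ (Finset.single_le_sum hterm hq)
        exact mul_le_mul_of_nonneg_left (pow_le_pow_left₀ hδ0.le hlt.le k) (hμ0 r)
      · rw [Set.indicator_of_notMem hr, mul_zero]
        exact Finset.sum_nonneg hterm
    rw [mul_comm]
    refine h1.trans ?_
    rw [resSum_sum]
    refine (Finset.sum_le_sum fun q hq =>
      moment_goodness_le hB hP hSM hSB hμ0 hμ1 hk hq).trans (le_of_eq ?_)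
    rw [hZ, Finset.mul_sum, Finset.mul_sum]
    refine Finset.sum_congr rfl fun q _ => ?_
    change (Real.exp lam * _ * W) ^ k * (V * β ^ k) = _
    rw [mul_pow, mul_pow, mul_pow, mul_pow]
    ring
  have hpow := pow_le_pow_left₀ (mul_nonneg (mul_nonneg h_prod0 hβ0) (Real.rpow_nonneg hZ0 _)) hC k
  rw [mul_pow, mul_pow _ ((1 - piGood) ^ _), one_div, Real.rpow_inv_natCast_pow hZ0 hk.ne',
    Real.rpow_inv_natCast_pow (sub_nonneg.2 hpi1) hk.ne', div_pow, div_mul_eq_mul_div,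
    le_div_iff₀ (pow_pos (Real.exp_pos lam) k)] at hpow
  have hbad' : mass Q μ (D \ T) ≤ V * (1 - piGood) := by
    refine le_of_mul_le_mul_right (hbad.trans ?_) (pow_pos hδ0 k)
    rw [mul_assoc V]
    refine mul_le_mul_of_nonneg_left (le_trans (le_of_eq ?_) (hpow.trans (le_of_eq ?_))) hμ1.le
    · rw [mul_assoc (Real.exp lam), mul_pow]
      ring
    · ring
  have hDV : mass Q μ D = V := mass_eq_univ_of_support hDμ
  have hadd := mass_add_mass_diff (Q := Q) (μ := μ) (A := T) (D := D) fun x hx => hx.1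
  rw [hDV] at hadd ⊢
  rw [le_div_iff₀ hμ1]
  linarith

/-- The factor `1 / piGood` comes from normalization: the new total mass is that of `T`, at least
`piGood` times the old one. -/
theorem maxShare_nextMeasure_le (hS0 : ∀ m ∈ S, m ≠ 0) (hlam : 0 ≤ lam) {piGood : ℝ}
    (hpi0 : 0 < piGood) {j : ℕ} {μ : ℤ → ℝ} {T : Set ℤ}
    (hμ : IsModPeriodic (period B P S j) μ) (hμ0 : ∀ x, 0 ≤ μ x)
    (hμ1 : 0 < mass (period B P S j) μ Set.univ)
    (hT : IsUnionOfClasses (period B P S j) T) (hTu : T ⊆ uncovered B P S a j)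
    (hTg : ∀ r ∈ T, IsGood B P S a lam j r)
    (hpi : piGood * mass (period B P S j) μ Set.univ ≤ mass (period B P S j) μ T)
    {m n : ℕ} (hm : m ∣ period B P S j) (hn : n ∣ newPeriod B P S (j + 1))
    (hf : Factorizes (block B P (j + 1) : Set ℕ) n) :
    maxShare (period B P S (j + 1)) (nextMeasure B P S a j μ T) (m * n) ≤
      1 / piGood * (maxShare (period B P S j) μ m *
        (Real.exp (lam * (baseOmega B n : ℝ)) / n)) := by
  have hm0 : 0 < m := Nat.pos_of_dvd_of_pos hm (period_pos hB j)
  have hn0 : 0 < n := Nat.pos_of_dvd_of_pos hn (newPeriod_pos hB _)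
  refine maxShare_le (Nat.mul_pos hm0 hn0) fun b => ?_
  rw [mass_nextMeasure_univ hB hP hS0 hlam hμ hT hTu hTg]
  set V := mass (period B P S j) μ Set.univ
  set w := Real.exp (lam * (baseOmega B n : ℝ)) / n with hw
  have hw0 : 0 ≤ w := by positivity
  have hVT : 0 < piGood * V := mul_pos hpi0 hμ1
  have h1 := mass_nextMeasure_le (a := a) hB hP hS0 hlam hμ hμ0 hT hTu hTg hm hn hf b
  have h2 : mass (period B P S j) μ {x | x ≡ b [ZMOD m]} ≤
      maxShare (period B P S j) μ m * V := (div_le_iff₀ hμ1).1 (share_le_maxShare hm0 b)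
  calc mass (period B P S (j + 1)) (nextMeasure B P S a j μ T)
        {x | x ≡ b [ZMOD ((m * n : ℕ) : ℤ)]} / mass (period B P S j) μ T
      ≤ w * (maxShare (period B P S j) μ m * V) / (piGood * V) :=
        div_le_div₀ (mul_nonneg hw0 (mul_nonneg (maxShare_nonneg hμ0 m) hμ1.le))
          (h1.trans (mul_le_mul_of_nonneg_left h2 hw0)) hVT hpi
    _ = 1 / piGood * (maxShare (period B P S j) μ m * w) := by
        field_simp

/-- Each entry of a tuple of divisors of `Q_{j+1}` splits into a divisor of `Q_j` and one of the new
period. The lcm splits accordingly, so the sum over tuples is at most the old bias sum times a sum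
of new weights. -/
theorem bias_nextMeasure_pow_le (hSM : ∀ m ∈ S, m ∈ M) (hS0 : ∀ m ∈ S, m ≠ 0) (hlam : 0 ≤ lam)
    {piGood : ℝ}
    (hpi0 : 0 < piGood) {j : ℕ} {μ : ℤ → ℝ} {T : Set ℤ}
    (hμ : IsModPeriodic (period B P S j) μ) (hμ0 : ∀ x, 0 ≤ μ x)
    (hμ1 : 0 < mass (period B P S j) μ Set.univ)
    (hT : IsUnionOfClasses (period B P S j) T) (hTu : T ⊆ uncovered B P S a j)
    (hTg : ∀ r ∈ T, IsGood B P S a lam j r)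
    (hpi : piGood * mass (period B P S j) μ Set.univ ≤ mass (period B P S j) μ T)
    {k : ℕ} (hk : 0 < k) :
    bias B (period B P S (j + 1)) (nextMeasure B P S a j μ T) k ^ k ≤
      1 / piGood * (∏ q ∈ block B P (j + 1), (1 + Real.exp lam * powerSum M q
        (fun l => ((l : ℝ) + 1) ^ k - (l : ℝ) ^ k))) * bias B (period B P S j) μ k ^ k := by
  classical
  have hQ := period_pos (P := P) (S := S) hB j
  have hQ1 := period_pos (P := P) (S := S) hB (j + 1)
  have hN := newPeriod_pos (P := P) (S := S) hB (j + 1)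
  have hKB := block_subset (B := B) (P := P) (j + 1)
  rw [bias_pow (nextMeasure_nonneg hμ0) B hQ1 hk, bias_pow hμ0 B hQ hk]
  set Y := Fintype.piFinset (fun _ : Fin k => baseDivisors B (period B P S (j + 1))) with hY
  set U := Fintype.piFinset (fun _ : Fin k => baseDivisors B (period B P S j)) with hU
  set W := Fintype.piFinset (fun _ : Fin k =>
    baseDivisors (block B P (j + 1) : Set ℕ) (newPeriod B P S (j + 1))) with hW
  -- Stated for every `x`, with the dummy value `(0, 0)` off the divisors, so that `choose` yields a
  -- total splitting function.
  have hsplit : ∀ x : ℕ, ∃ p : ℕ × ℕ, x ∈ baseDivisors B (period B P S (j + 1)) →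
      p.1 ∈ baseDivisors B (period B P S j) ∧
      p.2 ∈ baseDivisors (block B P (j + 1) : Set ℕ) (newPeriod B P S (j + 1)) ∧
      x = p.1 * p.2 := by
    intro x
    by_cases hx : x ∈ baseDivisors B (period B P S (j + 1))
    · obtain ⟨hxd, hxf⟩ := (mem_baseDivisors hQ1).1 hx
      rw [period_succ hB hP] at hxd
      obtain ⟨u, v, hu, hv, hud, hvd, he⟩ := Factorizes.split_of_dvd hB (blocksUpTo_subset j)
        (block_subset _) (disjoint_blocksUpTo_block hP j) (period_factorizes hB j)
        (newPeriod_factorizes _) hxf hxd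
      exact ⟨(u, v), fun _ => ⟨(mem_baseDivisors hQ).2 ⟨hud, hu.mono (blocksUpTo_subset j)⟩,
        (mem_baseDivisors hN).2 ⟨hvd, hv⟩, he⟩⟩
    · exact ⟨(0, 0), fun h => absurd h hx⟩
  choose s hs using hsplit
  let u : (Fin k → ℕ) → Fin k → ℕ := fun t l => (s (t l)).1
  let v : (Fin k → ℕ) → Fin k → ℕ := fun t l => (s (t l)).2
  have hst : ∀ t ∈ Y, ∀ l, u t l ∈ baseDivisors B (period B P S j) ∧
      v t l ∈ baseDivisors (block B P (j + 1) : Set ℕ) (newPeriod B P S (j + 1)) ∧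
      t l = u t l * v t l := fun t ht l => hs _ (Fintype.mem_piFinset.1 ht l)
  let w : (Fin k → ℕ) → ℝ := fun t => Real.exp (lam * (baseOmega B (Finset.univ.lcm t) : ℝ)) /
    ((Finset.univ.lcm t : ℕ) : ℝ)
  have hw0 : ∀ t, 0 ≤ w t := fun t => by positivity
  have hG0 : ∀ m, 0 ≤ maxShare (period B P S j) μ m := maxShare_nonneg hμ0
  have hterm : ∀ t ∈ Y, maxShare (period B P S (j + 1)) (nextMeasure B P S a j μ T)
      (Finset.univ.lcm t) ≤
        1 / piGood * (maxShare (period B P S j) μ (Finset.univ.lcm (u t)) * w (v t)) := by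
    intro t ht
    have hud : Finset.univ.lcm (u t) ∣ period B P S j := Finset.lcm_dvd fun l _ =>
      ((mem_baseDivisors hQ).1 (hst t ht l).1).1
    have hvd : Finset.univ.lcm (v t) ∣ newPeriod B P S (j + 1) := Finset.lcm_dvd fun l _ =>
      ((mem_baseDivisors hN).1 (hst t ht l).2.1).1
    have hvf : Factorizes (block B P (j + 1) : Set ℕ) (Finset.univ.lcm (v t)) :=
      (Factorizes.finset_lcm hB hKB Finset.univ (v t) fun l _ =>
        ((mem_baseDivisors hN).1 (hst t ht l).2.1).2).1
    have hlcm : Finset.univ.lcm t = Finset.univ.lcm (u t) * Finset.univ.lcm (v t) := by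
      refine Nat.dvd_antisymm (Finset.lcm_dvd fun l _ => ?_)
        (Nat.Coprime.mul_dvd_of_dvd_of_dvd ?_ (Finset.lcm_dvd fun l _ => ?_)
          (Finset.lcm_dvd fun l _ => ?_))
      · rw [(hst t ht l).2.2]
        exact mul_dvd_mul (Finset.dvd_lcm (Finset.mem_univ l)) (Finset.dvd_lcm (Finset.mem_univ l))
      · exact Nat.Coprime.of_dvd hud hvd (coprime_period_newPeriod hB hP j)
      · exact (Dvd.intro _ (hst t ht l).2.2.symm).trans (Finset.dvd_lcm (Finset.mem_univ l))
      · exact (Dvd.intro_left _ (hst t ht l).2.2.symm).trans (Finset.dvd_lcm (Finset.mem_univ l))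
    rw [hlcm]
    exact maxShare_nextMeasure_le hB hP hS0 hlam hpi0 hμ hμ0 hμ1 hT hTu hTg hpi hud hvd hvf
  have hinj : Set.InjOn (fun t => (u t, v t)) Y := by
    intro t ht t' ht' he
    simp only [Prod.mk.injEq] at he
    ext l
    rw [(hst t ht l).2.2, (hst t' ht' l).2.2, he.1, he.2]
  have hsum : ∑ t ∈ Y, maxShare (period B P S j) μ (Finset.univ.lcm (u t)) * w (v t) ≤
      (∑ t ∈ U, maxShare (period B P S j) μ (Finset.univ.lcm t)) * ∑ t ∈ W, w t := by
    rw [Finset.sum_mul_sum, ← Finset.sum_product',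
      ← Finset.sum_image (f := fun p : (Fin k → ℕ) × (Fin k → ℕ) =>
        maxShare (period B P S j) μ (Finset.univ.lcm p.1) * w p.2) hinj]
    refine Finset.sum_le_sum_of_subset_of_nonneg ?_ fun p _ _ => mul_nonneg (hG0 _) (hw0 _)
    intro p hp
    obtain ⟨t, ht, rfl⟩ := Finset.mem_image.1 hp
    exact Finset.mem_product.2 ⟨Fintype.mem_piFinset.2 fun l => (hst t ht l).1,
      Fintype.mem_piFinset.2 fun l => (hst t ht l).2.1⟩
  have hweight : ∑ t ∈ W, w t ≤ ∏ q ∈ block B P (j + 1), (1 + Real.exp lam * powerSum M q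
        (fun l => ((l : ℝ) + 1) ^ k - (l : ℝ) ^ k)) := by
    refine (sum_weight_lcm_le hB hKB hk W
      (fun t ht l => ((mem_baseDivisors hN).1 (Fintype.mem_piFinset.1 ht l)).2)
      (periodExponent B P S (j + 1)) fun t ht l q hq => ?_).trans
      (Finset.prod_le_prod (fun q _ => Finset.sum_nonneg fun l _ =>
        mul_nonneg (succ_pow_sub_pow_nonneg k l) (expWeight_nonneg _ _ _)) fun q hq =>
        sum_range_expWeight_le hB hSM hq (c := fun l => ((l : ℝ) + 1) ^ k - (l : ℝ) ^ k)
          (by simp [hk.ne']) (succ_pow_sub_pow_nonneg k)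
          (summable_succ_pow_sub_pow_div (hB.1 q (hKB (Finset.mem_coe.2 hq))) k))
    refine multiplicity_le_periodExponent hB ?_ hq
    rw [period_succ hB hP]
    exact (((mem_baseDivisors hN).1 (Fintype.mem_piFinset.1 ht l)).1).mul_left _
  refine (Finset.sum_le_sum hterm).trans ?_
  rw [← Finset.mul_sum, mul_assoc]
  refine mul_le_mul_of_nonneg_left (hsum.trans ?_) (by positivity)
  rw [mul_comm]
  exact mul_le_mul_of_nonneg_right hweight (Finset.sum_nonneg fun t _ => hG0 _)

omit hP in
theorem mass_initialMeasure_pos (hS0 : ∀ m ∈ S, m ≠ 0) (h0 : (uncovered B P S a 0).Nonempty) :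
    0 < mass (period B P S 0) (initialMeasure B P S a) Set.univ := by
  classical
  obtain ⟨x, hx⟩ := h0
  have hQ : (0 : ℤ) < period B P S 0 := by exact_mod_cast period_pos hB 0
  have hmem : x % period B P S 0 ∈ Finset.Ico (0 : ℤ) (period B P S 0) :=
    Finset.mem_Ico.2 ⟨Int.emod_nonneg _ hQ.ne', Int.emod_lt_of_pos _ hQ⟩
  have hu : x % period B P S 0 ∈ uncovered B P S a 0 :=
    isUnionOfClasses_uncovered hS0 0 _ _ (Int.mod_modEq _ _).symm hx
  have hc : 0 < classCount (period B P S 0) (uncovered B P S a 0) :=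
    Finset.card_pos.2 ⟨_, Finset.mem_filter.2 ⟨hmem, hu⟩⟩
  have hnn : ∀ y, 0 ≤ initialMeasure B P S a y := fun y => by
    unfold initialMeasure
    split_ifs <;> positivity
  rw [mass_eq_resSum, Set.indicator_univ]
  refine Finset.sum_pos' (fun y _ => hnn y) ⟨_, hmem, ?_⟩
  rw [initialMeasure, if_pos hu]
  positivity

/-- The measures of the construction are periodic, nonnegative, nonzero, and supported on
`R_{j-1}^* ∩ R_j`. -/
theorem stepMeasure_spec (hS0 : ∀ m ∈ S, m ≠ 0) (hlam : 0 ≤ lam) {piGood : ℝ}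
    (hpi0 : 0 < piGood) (h0 : (uncovered B P S a 0).Nonempty) {R : ℕ → Set ℤ} {i : ℕ}
    (hR : ∀ j < i, IsGoodSet B P S a lam piGood j (stepMeasure B P S a R j)
      (previousGood R j ∩ uncovered B P S a j) (R j)) :
    IsModPeriodic (period B P S i) (stepMeasure B P S a R i) ∧
    (∀ x, 0 ≤ stepMeasure B P S a R i x) ∧
    (∀ x, x ∉ previousGood R i ∩ uncovered B P S a i → stepMeasure B P S a R i x = 0) ∧
    IsUnionOfClasses (period B P S i) (previousGood R i ∩ uncovered B P S a i) ∧
    0 < mass (period B P S i) (stepMeasure B P S a R i) Set.univ := by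
  classical
  induction i with
  | zero =>
    have hu := isUnionOfClasses_uncovered (P := P) (B := B) (a := a) hS0 0
    refine ⟨fun x y hxy => ?_, fun x => ?_, fun x hx => ?_, ?_, mass_initialMeasure_pos hB hS0 h0⟩
    · simp only [stepMeasure, initialMeasure, hu.mem_iff hxy]
    · simp only [stepMeasure, initialMeasure]
      split_ifs <;> positivity
    · simp only [stepMeasure, initialMeasure]
      exact if_neg fun h => hx ⟨Set.mem_univ x, h⟩
    · simpa only [previousGood, Set.univ_inter] using hu
  | succ j ih =>
    obtain ⟨h1, h2, h3, h4, h5⟩ := ih fun l hl => hR l (hl.trans (Nat.lt_succ_self j))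
    have hg := hR j (Nat.lt_succ_self j)
    refine ⟨nextMeasure_periodic hS0 h1 hg.isUnionOfClasses, nextMeasure_nonneg h2,
      fun x hx => ?_, ?_, ?_⟩
    · simp only [stepMeasure, nextMeasure]
      exact if_neg hx
    · exact (hg.isUnionOfClasses.mono (period_dvd_period_succ j)).inter
        (isUnionOfClasses_uncovered hS0 _)
    · rw [stepMeasure, mass_nextMeasure_univ hB hP hS0 hlam h1 hg.isUnionOfClasses
        (fun x hx => (hg.subset hx).2) hg.isGood]
      -- Positivity of the mass propagates because the good set keeps a positive share of it.
      have hp := hpi0.trans_le hg.le_proportion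
      rw [mass_eq_univ_of_support h3] at hp
      exact (div_pos_iff_of_pos_right h5).1 hp

end Criterion

end CoveringSieve

end

theorem theorem3
    -- the base, the moduli, and the parameters
    (B M : Set ℕ) (hB : CoveringSieve.IsBase B)
    (hM1 : ∀ m ∈ M, 1 < m) (hM : ∀ m ∈ M, CoveringSieve.Factorizes B m)
    (P : ℕ → ℝ) (hP0 : 1 ≤ P 0) (hP : Monotone P)
    (lam piGood : ℝ) (hlam : 0 < lam) (hpi0 : 0 < piGood) (hpi1 : piGood ≤ 1)
    -- the finite set of moduli in use, and the residues
    (S : Finset ℕ) (hS : ∀ m ∈ S, m ∈ M) (a : ℕ → ℤ) (i : ℕ)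
    (hR0 : (CoveringSieve.uncovered B P S a 0).Nonempty)
    -- the good sets of the earlier steps
    (R : ℕ → Set ℤ)
    (hR : ∀ j < i, CoveringSieve.IsGoodSet B P S a lam piGood j
      (CoveringSieve.stepMeasure B P S a R j)
      (CoveringSieve.previousGood R j ∩ CoveringSieve.uncovered B P S a j) (R j))
    -- the criterion, for some moment `k`; denominators are cleared
    (hC : ∃ k : ℕ, 0 < k ∧
      (∏ q ∈ CoveringSieve.block B P (i + 1),
          (1 + Real.exp lam * CoveringSieve.powerSum M q (fun _ => 1))) *
        CoveringSieve.bias B (CoveringSieve.period B P S i)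
          (CoveringSieve.stepMeasure B P S a R i) k *
        (∑ q ∈ CoveringSieve.block B P (i + 1),
          CoveringSieve.powerSum M q (fun _ => 1) ^ k) ^ (1 / (k : ℝ)) ≤
      (1 - Real.exp (-lam)) / Real.exp lam * (1 - piGood) ^ (1 / (k : ℝ))) :
    -- for any choice `a'` of residues at step `i + 1` that keeps those of the steps up to `i`
    ∀ a' : ℕ → ℤ, (∀ m ∈ CoveringSieve.stepModuli B P S i, a' m = a m) →
      (∃ T : Set ℤ, CoveringSieve.IsGoodSet B P S a' lam piGood i
        (CoveringSieve.stepMeasure B P S a R i)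
        (CoveringSieve.previousGood R i ∩ CoveringSieve.uncovered B P S a i) T) ∧
      ∀ T : Set ℤ, CoveringSieve.IsGoodSet B P S a' lam piGood i
          (CoveringSieve.stepMeasure B P S a R i)
          (CoveringSieve.previousGood R i ∩ CoveringSieve.uncovered B P S a i) T →
        (∀ r ∈ T, ({x : ℤ | x ≡ r [ZMOD CoveringSieve.period B P S i]} ∩
          CoveringSieve.uncovered B P S a' (i + 1)).Nonempty) ∧
        ∀ k : ℕ, 0 < k →
          (CoveringSieve.bias B (CoveringSieve.period B P S (i + 1))
              (CoveringSieve.nextMeasure B P S a' i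
                (CoveringSieve.stepMeasure B P S a R i) T) k /
            CoveringSieve.bias B (CoveringSieve.period B P S i)
              (CoveringSieve.stepMeasure B P S a R i) k) ^ k ≤
          1 / piGood * ∏ q ∈ CoveringSieve.block B P (i + 1),
            (1 + Real.exp lam * CoveringSieve.powerSum M q
              (fun j => ((j : ℝ) + 1) ^ k - (j : ℝ) ^ k)) := by
  classical
  have hS0 : ∀ m ∈ S, m ≠ 0 := fun m hm => (zero_lt_one.trans (hM1 m (hS m hm))).ne'
  have hSB : ∀ m ∈ S, CoveringSieve.Factorizes B m := fun m hm => hM m (hS m hm)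
  obtain ⟨hμ, hμ0, hμs, hD, hμ1⟩ :=
    CoveringSieve.stepMeasure_spec hB hP hS0 hlam.le hpi0 hR0 hR
  intro a' ha'
  constructor
  · obtain ⟨k, hk, hC⟩ := hC
    exact ⟨_, CoveringSieve.isGoodSet_of_criterion hB hP hS hSB hlam hpi1 hμ0 hμ1 hD hμs hk hC⟩
  · intro T hT
    -- The old residues are unchanged, so `R_i` is the same set for `a` and `a'`.
    have hTu : T ⊆ CoveringSieve.uncovered B P S a' i := fun x hx m hm => by
      rw [ha' m hm]
      exact (hT.subset hx).2 m hm
    refine ⟨fun r hr => CoveringSieve.fiber_inter_uncovered_nonempty hB hP hS0 hlam.le (hTu hr)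
      (hT.isGood r hr), fun k hk => ?_⟩
    have hpi := hT.le_proportion
    rw [CoveringSieve.mass_eq_univ_of_support hμs, le_div_iff₀ hμ1] at hpi
    rw [div_pow]
    -- Only nonnegativity of the old bias is needed, since division by zero gives `0`.
    refine div_le_of_le_mul₀ (pow_nonneg (CoveringSieve.bias_nonneg hμ0 B k) k) ?_
      (CoveringSieve.bias_nextMeasure_pow_le hB hP hS hS0 hlam.le hpi0 hμ hμ0 hμ1
        hT.isUnionOfClasses hTu hT.isGood hpi hk)
    refine mul_nonneg (by positivity) (Finset.prod_nonneg fun q _ => add_nonneg zero_le_one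
      (mul_nonneg (Real.exp_nonneg _) (CoveringSieve.powerSum_nonneg
        (CoveringSieve.succ_pow_sub_pow_nonneg k))))
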